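/- Let $\alpha\in[0,1]$. Let $T_\alpha$ be given by $T_\alpha(0)=0$ and $T_\alpha(x)=\frac{\epsilon(x)}{x}-c_\alpha(x)$ for $x\neq0$, where $\epsilon(x)=\operatorname{sgn}(x)$ and $c_\alpha(x)=\left\lfloor \frac1{|x|}+1-\alpha\right\rfloor$. The unfolded Wilton function $\tilde W_\alpha$ is the $1$-periodic function with $$\tilde W_\alpha(x)=\sum_{j\ge0}(-1)^j\Big(\prod_{i=0}^{j-1}|T_\alpha^i(x)|\Big)\log\frac1{|T_\alpha^j(x)|}\qquad\text{for a.e. }x\in[\alpha-1,\alpha).$$ For a function $w$ that is integrable on an open interval around $\xi$, the point $\xi$ is a singularity of type A if $\frac1{|h|}\int_\xi^{\xi+h}w(t)\,dt$ tends to $+\infty$, or tends to $-\infty$, as $h\to0$ (two-sided limit); it is a singularity of type B if the same holds for $\frac1h\int_\xi^{\xi+h}w(t)\,dt$. (Being of type A or B includes integrability of $w$ near $\xi$.) For $n\in\mathbb N=\{0,1,2,\dots\}$ put $$M_{\alpha,x,n}=\prod_{i=0}^{n-1}\begin{pmatrix}0&\epsilon(T_\alpha^i(x))\\1&c_\alpha(T_\alpha^i(x))\end{pmatrix}$$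 (factors ordered from left to right), defined when $T_\alpha^i(x)\ne0$ for all $i<n$. A parameter $\alpha\in(0,1]$ satisfies $(n,m)_{\rm alg}$ if $M_{\alpha,\alpha,n}$ and $M_{\alpha,\alpha-1,m}$ are defined and $$M_{\alpha,\alpha,n}=\begin{pmatrix}1&1\\0&1\end{pmatrix}M_{\alpha,\alpha-1,m}\begin{pmatrix}-1&0\\1&1\end{pmatrix}.$$ A matching interval with exponents $(n,m)$ is a connected component of the interior, relative to $(0,1]$, of the set of parameters satisfying $(n,m)_{\rm alg}$; its index is $m-n$. **Theorem.** Let $\alpha\in[0,1]$ and $\xi\in[\alpha-1,\alpha)\cap\mathbb Q$. (i) If $\{\alpha,\alpha-1\}\cap\{T_\alpha^k(\xi):k\in\mathbb N\}=\emptyset$, then $\xi$ is a type B singularity of $\tilde W_\alpha$. (ii) Otherwise $\alpha\in\mathbb Q$, and $\xi$ is a type B singularity of $\tilde W_\alpha$ if and only if $\alpha$ belongs to a matching interval of even index; if $\alpha$ belongs to a matching interval of odd index, then $\xi$ is a type A singularity of $\tilde W_\alpha$. -/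

import Mathlib

open Set Filter Topology MeasureTheory

noncomputable section

namespace AlphaCF

/-- The sign `ε(x) ∈ {-1, 0, 1}` of `x`, as an integer. -/
def eps (x : ℝ) : ℤ := ((SignType.sign x : SignType) : ℤ)

/-- The digit `c_α(x) = ⌊1/|x| + 1 - α⌋` (meaningful for `x ≠ 0`). -/
def digit (α x : ℝ) : ℤ := ⌊1 / |x| + 1 - α⌋

/-- The unfolded `α`-continued fraction map: `T_α(0) = 0` and `T_α(x) = ε(x)/x - c_α(x)` for
`x ≠ 0`. It is given by the formula on all of `ℝ`, because the matching condition also uses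
the orbit of the right endpoint `α` of `[α - 1, α)`. -/
def T (α x : ℝ) : ℝ := if x = 0 then 0 else (eps x : ℝ) / x - (digit α x : ℝ)

/-- The product `|x| |T_α x| ⋯ |T_α^{j-1} x|` of the first `j` absolute values along the orbit
(equal to `1` for `j = 0`). -/
def betaProd (α x : ℝ) (j : ℕ) : ℝ := ∏ i ∈ Finset.range j, |(T α)^[i] x|

/-- The Wilton series on `[α - 1, α)`, summed as the limit of its partial sums in the natural
order (so that conditional convergence is allowed). Its value at points where the series does not
converge, or at rational points, is immaterial: only integrals of the function are used. -/
def wiltonSeries (α x : ℝ) : ℝ :=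
  ∑'[SummationFilter.conditional ℕ] j : ℕ,
    (-1 : ℝ) ^ j * betaProd α x j * Real.log (1 / |(T α)^[j] x|)

/-- The unfolded Wilton function: the `1`-periodic function that is given by the Wilton
series on `[α - 1, α)`; the point `x - ⌊x + 1 - α⌋` is the representative of `x` modulo `1` there. -/
def wilton (α x : ℝ) : ℝ := wiltonSeries α (x - (⌊x + 1 - α⌋ : ℝ))

/-- Type A singularity: `w` is integrable on an open interval around `ξ`, and
`(1/|h|) ∫_ξ^{ξ+h} w` tends to `+∞`, or to `-∞`, as `h → 0` (from both sides). -/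
def IsTypeA (w : ℝ → ℝ) (ξ : ℝ) : Prop :=
  (∃ a b : ℝ, ξ ∈ Ioo a b ∧ IntegrableOn w (Ioo a b)) ∧
  (Tendsto (fun h : ℝ => (1 / |h|) * ∫ t in ξ..(ξ + h), w t) (𝓝[≠] 0) atTop ∨
   Tendsto (fun h : ℝ => (1 / |h|) * ∫ t in ξ..(ξ + h), w t) (𝓝[≠] 0) atBot)

/-- Type B singularity: as type A, with `1/h` in place of `1/|h|`. -/
def IsTypeB (w : ℝ → ℝ) (ξ : ℝ) : Prop :=
  (∃ a b : ℝ, ξ ∈ Ioo a b ∧ IntegrableOn w (Ioo a b)) ∧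
  (Tendsto (fun h : ℝ => (1 / h) * ∫ t in ξ..(ξ + h), w t) (𝓝[≠] 0) atTop ∨
   Tendsto (fun h : ℝ => (1 / h) * ∫ t in ξ..(ξ + h), w t) (𝓝[≠] 0) atBot)

/-- The matrix `M_{α,x,n}`, the product over `i < n` of the matrices
`(0, ε(T_α^i x); 1, c_α(T_α^i x))`, in this order. -/
def cfMatrix (α x : ℝ) : ℕ → Matrix (Fin 2) (Fin 2) ℤ
  | 0 => 1
  | n + 1 => cfMatrix α x n * !![0, eps ((T α)^[n] x); 1, digit α ((T α)^[n] x)]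

/-- The algebraic matching condition `(n, m)_alg`. The first two clauses say that the digits
entering the two matrices are defined, i.e. that neither orbit reaches `0` too early. -/
def AlgMatching (n m : ℕ) (α : ℝ) : Prop :=
  (∀ i < n, (T α)^[i] α ≠ 0) ∧ (∀ i < m, (T α)^[i] (α - 1) ≠ 0) ∧
  cfMatrix α α n = !![1, 1; 0, 1] * cfMatrix α (α - 1) m * !![-1, 0; 1, 1]

/-- The interior, relative to `(0, 1]`, of the set of parameters satisfying `(n, m)_alg`. -/
def matchingInterior (n m : ℕ) : Set ℝ :=
  {x | x ∈ Ioc (0 : ℝ) 1 ∧ ∀ᶠ y in 𝓝[Ioc (0 : ℝ) 1] x, AlgMatching n m y}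

/-- `J` is a matching interval with matching exponents `(n, m)`: a connected component of the
(relatively) open set of parameters around which `(n, m)_alg` holds. Equivalently, `J` is a maximal
relatively open subinterval of `(0, 1]` all of whose points satisfy `(n, m)_alg`. -/
def IsMatchingInterval (n m : ℕ) (J : Set ℝ) : Prop :=
  ∃ x ∈ matchingInterior n m, J = connectedComponentIn (matchingInterior n m) x

/-- `α` belongs to a matching interval whose matching index `m - n` is even. -/
def InEvenMatchingInterval (α : ℝ) : Prop :=
  ∃ (J : Set ℝ) (n m : ℕ), IsMatchingInterval n m J ∧ α ∈ J ∧ Even ((m : ℤ) - (n : ℤ))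

/-- `α` belongs to a matching interval whose matching index `m - n` is odd. -/
def InOddMatchingInterval (α : ℝ) : Prop :=
  ∃ (J : Set ℝ) (n m : ℕ), IsMatchingInterval n m J ∧ α ∈ J ∧ Odd ((m : ℤ) - (n : ℤ))

end AlphaCF

end

noncomputable section

namespace AlphaCF

/-! The proof rests on the functional equation `W(x) + |x| W(T x) = -log |x|` on `[α - 1, α)`,
where `W = wilton α` is integrable. Near a nonzero rational point it transfers the divergence of
one-sided averages of `W` from `ξ` to `T ξ`, reversing the sign of the limit at each step; near `0`
the averages tend to `+∞` because `-log |x|` dominates. A rational orbit that avoids `α - 1` reaches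
`0` after `k` steps, so both one-sided limits at `ξ` are `(-1)^k ∞`. If instead it reaches `α - 1`,
then the right side of `α - 1` follows the orbit of `α - 1` down to `0`, while by periodicity the
left side of `α - 1` is the left side of `α` and follows the orbit of `α`. Hence the two signs agree
iff the numbers of steps `m₀`, `n₀` of these orbits have the same parity, and algebraic matching
with exponents `(n, m)` forces `m - n = m₀ - n₀`. Every rational parameter lies in a matching
interval: the matching identity is propagated by induction on the denominator. -/

/-! ### Steps of the algorithm -/

section Step

variable {α x y : ℝ} {c : ℤ}

theorem eps_of_pos (hx : 0 < x) : eps x = 1 := by simp [eps, sign_pos hx]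

theorem eps_of_neg (hx : x < 0) : eps x = -1 := by simp [eps, sign_neg hx]

theorem eps_mul_self (hx : x ≠ 0) : eps x * eps x = 1 := by
  rcases hx.lt_or_gt with h | h
  · simp [eps_of_neg h]
  · simp [eps_of_pos h]

theorem eps_mul_abs (x : ℝ) : (eps x : ℝ) * |x| = x := by simp [eps]

theorem T_zero (α : ℝ) : T α 0 = 0 := by simp [T]

theorem T_of_ne_zero (hx : x ≠ 0) : T α x = 1 / |x| - (digit α x : ℝ) := by
  have hε : (eps x : ℝ) / x = 1 / |x| := by
    rcases hx.lt_or_gt with h | h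
    · simp [eps_of_neg h, abs_of_neg h, neg_div, div_neg]
    · simp [eps_of_pos h, abs_of_pos h]
  rw [T, if_neg hx, hε]

theorem T_mem_Ico (hx : x ≠ 0) : T α x ∈ Ico (α - 1) α := by
  rw [T_of_ne_zero hx, digit]
  constructor <;>
    linarith [Int.floor_le (1 / |x| + 1 - α), Int.lt_floor_add_one (1 / |x| + 1 - α)]

theorem mapsTo_T (α : ℝ) : MapsTo (T α) (Ico (α - 1) α) (Ico (α - 1) α) := by
  intro x hx
  rcases eq_or_ne x 0 with rfl | h
  · rwa [T_zero]
  · exact T_mem_Ico h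

theorem iterate_T_mem_Ico (hx : x ∈ Ico (α - 1) α) (n : ℕ) : (T α)^[n] x ∈ Ico (α - 1) α :=
  (mapsTo_T α).iterate n hx

theorem abs_lt_one_of_mem_Ico (h0 : 0 < α) (h1 : α ≤ 1) (hx : x ∈ Ico (α - 1) α) : |x| < 1 :=
  abs_lt.mpr ⟨by linarith [hx.1], by linarith [hx.2]⟩

theorem abs_T_lt_one (h0 : 0 < α) (h1 : α ≤ 1) (x : ℝ) : |T α x| < 1 := by
  rcases eq_or_ne x 0 with rfl | hx
  · simp [T_zero]
  · exact abs_lt_one_of_mem_Ico h0 h1 (T_mem_Ico hx)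

theorem digit_eq_of_sub_mem_Ico (h : 1 / |x| - c ∈ Ico (α - 1) α) : digit α x = c := by
  rw [digit, Int.floor_eq_iff]
  constructor <;> linarith [h.1, h.2]

theorem T_eq_of_sub_mem_Ico (hx : x ≠ 0) (h : 1 / |x| - c ∈ Ico (α - 1) α) :
    T α x = 1 / |x| - c := by
  rw [T_of_ne_zero hx, digit_eq_of_sub_mem_Ico h]

theorem digit_eq_digit_add (h : 1 / |x| = 1 / |y| + c) : digit α x = digit α y + c := by
  rw [digit, digit, h, ← Int.floor_add_intCast]
  congr 1
  ring

theorem T_eq_T_of_one_div_abs (hx : x ≠ 0) (hy : y ≠ 0) (h : 1 / |x| = 1 / |y| + c) :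
    T α x = T α y := by
  rw [T_of_ne_zero hx, T_of_ne_zero hy, digit_eq_digit_add h, h]
  push_cast
  ring

end Step

/-! ### Rational orbits -/

section Rational

variable {α : ℝ} {r : ℚ}

/-- The map `T_α` on rational numbers. -/
def ratT (α : ℝ) (r : ℚ) : ℚ := if r = 0 then 0 else 1 / |r| - digit α r

theorem semiconj_ratT (α : ℝ) : Function.Semiconj ((↑) : ℚ → ℝ) (ratT α) (T α) := by
  intro r
  rcases eq_or_ne r 0 with rfl | hr
  · simp [ratT, T_zero]
  · rw [T_of_ne_zero (by exact_mod_cast hr), ratT, if_neg hr]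
    push_cast
    rfl

theorem cast_iterate_ratT (α : ℝ) (r : ℚ) (n : ℕ) :
    (((ratT α)^[n] r : ℚ) : ℝ) = (T α)^[n] r := (semiconj_ratT α).iterate_right n r

theorem den_ratT (hr : r ≠ 0) : (ratT α r).den = r.num.natAbs := by
  rw [ratT, if_neg hr, Rat.sub_intCast_den, one_div, Rat.den_inv_of_ne_zero (abs_ne_zero.mpr hr),
    Rat.num_abs_eq_abs_num, Int.natAbs_abs]

theorem natAbs_num_lt_den (hr : |(r : ℝ)| < 1) : r.num.natAbs < r.den := by
  have h : |r| < 1 := by exact_mod_cast hr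
  rw [Rat.abs_def, Rat.divInt_eq_div, div_lt_one (by exact_mod_cast r.pos)] at h
  exact_mod_cast h

theorem den_ratT_lt (hr : r ≠ 0) (h : |(r : ℝ)| < 1) : (ratT α r).den < r.den :=
  den_ratT hr ▸ natAbs_num_lt_den h

/-- The value `-1` is possible for `α = 0` only, where it is a fixed point of `T_α`. -/
theorem exists_iterate_T_eq_zero_or_neg_one (hα : α ∈ Icc (0 : ℝ) 1) (r : ℚ)
    (hr : (r : ℝ) ∈ Ico (α - 1) α) : ∃ k, (T α)^[k] r = 0 ∨ (T α)^[k] r = -1 := by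
  induction hd : r.den using Nat.strong_induction_on generalizing r with
  | _ d ih =>
  subst hd
  by_cases h0 : (r : ℝ) = 0
  · exact ⟨0, Or.inl h0⟩
  by_cases h1 : (r : ℝ) = -1
  · exact ⟨0, Or.inr h1⟩
  have habs : |(r : ℝ)| < 1 := abs_lt.mpr
    ⟨lt_of_le_of_ne (by linarith [hr.1, hα.1]) (Ne.symm h1), by linarith [hr.2, hα.2]⟩
  have hT : ((ratT α r : ℚ) : ℝ) = T α r := semiconj_ratT α r
  obtain ⟨k, hk⟩ := ih _ (den_ratT_lt (by exact_mod_cast h0) habs) (ratT α r)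
    (hT ▸ T_mem_Ico h0) rfl
  exact ⟨k + 1, by rwa [Function.iterate_succ_apply, ← hT]⟩

theorem exists_iterate_T_eq_zero (h0 : 0 < α) (h1 : α ≤ 1) (hr : (r : ℝ) ∈ Ico (α - 1) α) :
    ∃ k, (T α)^[k] r = 0 := by
  obtain ⟨k, hk | hk⟩ := exists_iterate_T_eq_zero_or_neg_one ⟨h0.le, h1⟩ r hr
  · exact ⟨k, hk⟩
  · linarith [(iterate_T_mem_Ico hr k).1]

theorem iterate_ratT_eq_zero_or_den_lt (hr : |(r : ℝ)| < 1) (h0 : 0 < α) (h1 : α ≤ 1) (n : ℕ) :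
    (ratT α)^[n + 1] r = 0 ∨ ((ratT α)^[n + 1] r).den < r.den := by
  have step : ∀ s : ℚ, |(s : ℝ)| < 1 → ratT α s = 0 ∨ (ratT α s).den < s.den := by
    intro s hs
    rcases eq_or_ne s 0 with rfl | h
    · exact Or.inl (by simp [ratT])
    · exact Or.inr (den_ratT_lt h hs)
  induction n with
  | zero => exact step r hr
  | succ n ih =>
    rw [Function.iterate_succ_apply']
    have habs : |(((ratT α)^[n + 1] r : ℚ) : ℝ)| < 1 := by
      rw [Function.iterate_succ_apply', semiconj_ratT]
      exact abs_T_lt_one h0 h1 _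
    rcases ih with h | h
    · exact Or.inl (by simp [h, ratT])
    · exact (step _ habs).imp_right h.trans'

/-- Otherwise the denominator of `α - 1`, which is that of `r`, would have decreased. -/
theorem iterate_T_ne_sub_one {a : ℚ} (h0 : 0 < (a : ℝ)) (h1 : (a : ℝ) < 1) (hr : |(r : ℝ)| < 1)
    (hden : r.den = a.den) (n : ℕ) : (T a)^[n + 1] (r : ℝ) ≠ a - 1 := by
  intro h
  have h' : (ratT a)^[n + 1] r = a - (1 : ℤ) := by
    rw [← cast_iterate_ratT] at h
    push_cast
    exact_mod_cast h
  rcases iterate_ratT_eq_zero_or_den_lt hr h0 h1.le n with hz | hlt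
  · rw [h', sub_eq_zero] at hz
    rw [hz] at h1
    simp at h1
  · rw [h', Rat.sub_intCast_den] at hlt
    omega

end Rational

/-! ### The matching relation between orbits -/

section Matrices

open scoped Matrix

variable {α x : ℝ} {n : ℕ}

theorem cfMatrix_zero (α x : ℝ) : cfMatrix α x 0 = 1 := rfl

theorem cfMatrix_succ (α x : ℝ) (n : ℕ) : cfMatrix α x (n + 1) =
    cfMatrix α x n * !![0, eps ((T α)^[n] x); 1, digit α ((T α)^[n] x)] := rfl

theorem cfMatrix_one (α x : ℝ) : cfMatrix α x 1 = !![0, eps x; 1, digit α x] := one_mul _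

theorem cfMatrix_add (α x : ℝ) (j m : ℕ) :
    cfMatrix α x (j + m) = cfMatrix α x j * cfMatrix α ((T α)^[j] x) m := by
  induction m with
  | zero => rw [cfMatrix_zero, mul_one, add_zero]
  | succ m ih =>
    rw [← add_assoc, cfMatrix_succ, ih, cfMatrix_succ, mul_assoc, ← Function.iterate_add_apply,
      add_comm m j]

theorem iterate_T_ne_zero_of_add {j m : ℕ} (hj : ∀ i < j, (T α)^[i] x ≠ 0)
    (hm : ∀ i < m, (T α)^[i] ((T α)^[j] x) ≠ 0) : ∀ i < j + m, (T α)^[i] x ≠ 0 := by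
  intro i hi
  rcases lt_or_ge i j with h | h
  · exact hj i h
  · obtain ⟨r, rfl⟩ := Nat.exists_eq_add_of_le' h
    rw [Function.iterate_add_apply]
    exact hm r (by omega)

theorem isUnit_det_cfMatrix (h : ∀ i < n, (T α)^[i] x ≠ 0) : IsUnit (cfMatrix α x n).det := by
  induction n with
  | zero => simp [cfMatrix_zero]
  | succ n ih =>
    have hε : IsUnit (eps ((T α)^[n] x)) := .of_mul_eq_one _ (eps_mul_self (h n n.lt_succ_self))
    rw [cfMatrix_succ, Matrix.det_mul]
    exact (ih fun i hi => h i (by omega)).mul (by simpa [Matrix.det_fin_two_of] using hε)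

/-- As a Möbius transformation, `M_{α,x,n}` maps `T_α^n x` to `x`. -/
theorem cfMatrix_mulVec (h : ∀ i < n, (T α)^[i] x ≠ 0) :
    (cfMatrix α x n).map ((↑) : ℤ → ℝ) *ᵥ ![(T α)^[n] x, 1] = (betaProd α x n)⁻¹ • ![x, 1] := by
  induction n with
  | zero => simp [cfMatrix_zero, betaProd]
  | succ n ih =>
    have hn := h n n.lt_succ_self
    have hstep : (!![0, eps ((T α)^[n] x); 1, digit α ((T α)^[n] x)]).map ((↑) : ℤ → ℝ) *ᵥ
        ![(T α)^[n + 1] x, 1] = |(T α)^[n] x|⁻¹ • ![(T α)^[n] x, 1] := by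
      rw [Function.iterate_succ_apply', T_of_ne_zero hn]
      generalize (T α)^[n] x = y at hn
      have hε : (eps y : ℝ) = |y|⁻¹ * y := by
        rw [eq_inv_mul_iff_mul_eq₀ (abs_ne_zero.mpr hn), mul_comm, eps_mul_abs]
      ext i
      fin_cases i <;> simp [Matrix.mulVec, dotProduct, hε]
    rw [cfMatrix_succ, Matrix.map_mul_intCast, ← Matrix.mulVec_mulVec, hstep, Matrix.mulVec_smul,
      ih fun i hi => h i (by omega), smul_smul, betaProd, betaProd, Finset.prod_range_succ, mul_inv,
      mul_comm]

theorem betaProd_pos (h : ∀ i < n, (T α)^[i] x ≠ 0) : 0 < betaProd α x n :=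
  Finset.prod_pos fun i hi => abs_pos.mpr (h i (Finset.mem_range.mp hi))

end Matrices

section Index

open scoped Matrix

variable {α : ℝ} {n m : ℕ}

/-- Two points related by the Möbius transformation `a ↦ -a / (1 + a)`, as the points
`T_α^n α` and `T_α^m (α - 1)` are after matching with exponents `(n, m)`. -/
structure IsMatchedPair (a b : ℝ) : Prop where
  pos : 0 < 1 + a
  eq : (1 + a) * b = -a

theorem mulVec_injective_map_cast {M : Matrix (Fin 2) (Fin 2) ℤ} (hM : IsUnit M.det) :
    Function.Injective (M.map ((↑) : ℤ → ℝ)).mulVec := by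
  refine Matrix.mulVec_injective_of_det_ne_zero ?_
  rw [← Int.cast_det]
  exact_mod_cast hM.ne_zero

theorem AlgMatching.isMatchedPair (h : AlgMatching n m α) :
    IsMatchedPair ((T α)^[n] α) ((T α)^[m] (α - 1)) := by
  obtain ⟨hn, hm, hM⟩ := h
  have hα := cfMatrix_mulVec hn
  have hα' := cfMatrix_mulVec hm
  have hβ := betaProd_pos hn
  have hβ' := betaProd_pos hm
  set a := (T α)^[n] α
  set b := (T α)^[m] (α - 1)
  set κ := (betaProd α α n)⁻¹ * betaProd α (α - 1) m
  have hκ : 0 < κ := mul_pos (inv_pos.mpr hβ) hβ'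
  have hU : (!![1, 1; 0, 1] : Matrix (Fin 2) (Fin 2) ℤ).map ((↑) : ℤ → ℝ) *ᵥ ![α - 1, 1] =
      ![α, 1] := by
    ext i; fin_cases i <;> simp [Matrix.mulVec, dotProduct]
  have hP : (!![-1, 0; 1, 1] : Matrix (Fin 2) (Fin 2) ℤ).map ((↑) : ℤ → ℝ) *ᵥ ![a, 1] =
      ![-a, a + 1] := by
    ext i; fin_cases i <;> simp [Matrix.mulVec, dotProduct]
  have hvec : ![-a, a + 1] = κ • ![b, 1] := by
    refine mulVec_injective_map_cast (M := !![1, 1; 0, 1] * cfMatrix α (α - 1) m) ?_ ?_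
    · rw [Matrix.det_mul]
      exact .mul (by simp [Matrix.det_fin_two_of]) (isUnit_det_cfMatrix hm)
    · simp only [← hP, Matrix.mulVec_mulVec, ← Matrix.map_mul_intCast, ← hM, Matrix.mulVec_smul]
      rw [hα, Matrix.map_mul_intCast, ← Matrix.mulVec_mulVec, hα', Matrix.mulVec_smul, hU,
        smul_smul, mul_inv_cancel_right₀ hβ'.ne']
  have h0 : -a = κ * b := by simpa using congrFun hvec 0
  have h1 : a + 1 = κ := by simpa using congrFun hvec 1
  exact ⟨by linarith, by rw [h0, ← h1, add_comm]⟩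

theorem IsMatchedPair.eq_zero_iff {a b : ℝ} (h : IsMatchedPair a b) : a = 0 ↔ b = 0 := by
  rw [← neg_eq_zero, ← h.eq, mul_eq_zero, or_iff_right h.pos.ne']

theorem IsMatchedPair.T_eq {a b : ℝ} (h : IsMatchedPair a b) (ha : a ≠ 0) : T α a = T α b := by
  have hb : b ≠ 0 := mt h.eq_zero_iff.mpr ha
  have hb' : b = -a / (1 + a) := by rw [eq_div_iff h.pos.ne', mul_comm, h.eq]
  have habs : |b| = |a| / (1 + a) := by rw [hb', abs_div, abs_neg, abs_of_pos h.pos]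
  refine T_eq_T_of_one_div_abs (c := -eps a) ha hb ?_
  have hε := eps_mul_abs a
  have := abs_ne_zero.mpr ha
  rw [habs]
  push_cast
  field_simp
  linear_combination hε

/-- The orbit of `x` reaches `0` for the first time after `k` steps. -/
def FirstZero (α x : ℝ) (k : ℕ) : Prop := (T α)^[k] x = 0 ∧ ∀ i < k, (T α)^[i] x ≠ 0

theorem exists_firstZero {x : ℝ} (h : ∃ k, (T α)^[k] x = 0) : ∃ k, FirstZero α x k := by
  classical
  exact ⟨Nat.find h, Nat.find_spec h, fun i hi => Nat.find_min h hi⟩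

theorem FirstZero.unique {x : ℝ} {k l : ℕ} (hk : FirstZero α x k) (hl : FirstZero α x l) :
    k = l :=
  le_antisymm (not_lt.mp fun h => hk.2 l h hl.1) (not_lt.mp fun h => hl.2 k h hk.1)

theorem FirstZero.iterate {x : ℝ} {k n : ℕ} (hk : FirstZero α x (n + k)) :
    FirstZero α ((T α)^[n] x) k := by
  refine ⟨by rw [← Function.iterate_add_apply, add_comm, hk.1], fun i hi => ?_⟩
  rw [← Function.iterate_add_apply]
  exact hk.2 _ (by omega)

theorem FirstZero.pos_iff {x : ℝ} {k : ℕ} (hk : FirstZero α x k) : 0 < k ↔ x ≠ 0 := by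
  refine ⟨fun h => hk.2 0 h, fun h => Nat.pos_of_ne_zero ?_⟩
  rintro rfl
  exact h hk.1

theorem IsMatchedPair.firstZero_eq {a b : ℝ} {r s : ℕ} (h : IsMatchedPair a b)
    (ha : FirstZero α a r) (hb : FirstZero α b s) : r = s := by
  rcases eq_or_ne a 0 with h0 | h0
  · rw [h.eq_zero_iff.mp h0, ← h0] at hb
    exact ha.unique hb
  obtain ⟨r, rfl⟩ := Nat.exists_eq_add_of_le (ha.pos_iff.mpr h0)
  obtain ⟨s, rfl⟩ := Nat.exists_eq_add_of_le (hb.pos_iff.mpr (mt h.eq_zero_iff.mpr h0))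
  have ha' : FirstZero α (T α a) r := ha.iterate
  have hb' : FirstZero α (T α b) s := hb.iterate
  rw [h.T_eq h0] at ha'
  rw [ha'.unique hb']

theorem AlgMatching.index_eq {n₀ m₀ : ℕ} (h : AlgMatching n m α)
    (hn : FirstZero α α n₀) (hm : FirstZero α (α - 1) m₀) : (m : ℤ) - n = m₀ - n₀ := by
  obtain ⟨r, rfl⟩ := Nat.exists_eq_add_of_le (not_lt.mp fun hc => h.1 n₀ hc hn.1)
  obtain ⟨s, rfl⟩ := Nat.exists_eq_add_of_le (not_lt.mp fun hc => h.2.1 m₀ hc hm.1)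
  have : r = s := h.isMatchedPair.firstZero_eq hn.iterate hm.iterate
  omega

end Index

section Existence

variable {α A t : ℝ} {x y : ℝ} {n m : ℕ}

theorem cfMatrix_succ_eq_mul {c : ℤ} (hx : x ≠ 0) (hy : y ≠ 0) (h : 1 / |x| = 1 / |y| + c) (n : ℕ) :
    cfMatrix α x (n + 1) = !![eps x * eps y, 0; c * eps y, 1] * cfMatrix α y (n + 1) := by
  rw [add_comm, cfMatrix_add, cfMatrix_add, cfMatrix_one, cfMatrix_one, Function.iterate_one,
    T_eq_T_of_one_div_abs hx hy h, digit_eq_digit_add h, ← mul_assoc]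
  congr 1
  have hε := eps_mul_self hy
  simp [mul_assoc, hε, add_comm]

theorem cfMatrix_neg_succ (hx : x ≠ 0) (n : ℕ) :
    cfMatrix α (-x) (n + 1) = !![-1, 0; 0, 1] * cfMatrix α x (n + 1) := by
  rw [cfMatrix_succ_eq_mul (c := 0) (neg_ne_zero.mpr hx) hx (by simp)]
  have hε : eps (-x) * eps x = -1 := by
    rw [show eps (-x) = -eps x by simp [eps, Left.sign_neg], neg_mul, eps_mul_self hx]
  simp [hε]

theorem iterate_T_neg (hx : x ≠ 0) (n : ℕ) : (T α)^[n + 1] (-x) = (T α)^[n + 1] x := by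
  rw [Function.iterate_succ_apply, Function.iterate_succ_apply,
    T_eq_T_of_one_div_abs (c := 0) (neg_ne_zero.mpr hx) hx (by simp)]

theorem iterate_T_ne_zero_of_succ_eq {k : ℕ} (hx : x ≠ 0)
    (hy : ∀ i < k, (T α)^[i] y ≠ 0) (h : T α x = T α y) : ∀ i < k, (T α)^[i] x ≠ 0 := by
  rintro (_ | i) hi
  · exact hx
  · rw [Function.iterate_succ_apply, h, ← Function.iterate_succ_apply]
    exact hy _ hi

/-- The condition `(n, m)_alg` of the parameter `α`, with the orbits of `A` and `A - 1` in place of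
those of `α` and `α - 1`. For `0 < n, m` it is symmetric under `A ↦ 1 - A`. -/
def PairMatching (α A : ℝ) (n m : ℕ) : Prop :=
  (∀ i < n, (T α)^[i] A ≠ 0) ∧ (∀ i < m, (T α)^[i] (A - 1) ≠ 0) ∧
  cfMatrix α A n = !![1, 1; 0, 1] * cfMatrix α (A - 1) m * !![-1, 0; 1, 1]

theorem PairMatching.symm (h : PairMatching α A (n + 1) (m + 1)) :
    PairMatching α (1 - A) (m + 1) (n + 1) := by
  obtain ⟨hn, hm, hM⟩ := h
  have hA : A ≠ 0 := hn 0 n.succ_pos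
  have hA' : A - 1 ≠ 0 := hm 0 m.succ_pos
  have e : 1 - A = -(A - 1) := by ring
  have e' : 1 - A - 1 = -A := by ring
  refine ⟨iterate_T_ne_zero_of_succ_eq (e ▸ neg_ne_zero.mpr hA') hm ?_,
    iterate_T_ne_zero_of_succ_eq (e' ▸ neg_ne_zero.mpr hA) hn ?_, ?_⟩
  · rw [e]; exact iterate_T_neg hA' 0
  · rw [e']; exact iterate_T_neg hA 0
  · rw [e', e, cfMatrix_neg_succ hA, cfMatrix_neg_succ hA', hM]
    simp only [← mul_assoc]
    rw [mul_assoc _ (!![-1, 0; 1, 1]) (!![-1, 0; 1, 1])]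
    simp [Matrix.one_fin_two.symm]

theorem abs_one_div_add_one_sub_one {s : ℝ} (hs : 0 < s) :
    1 / |1 / (s + 1) - 1| = 1 / s + 1 := by
  have h : 1 / (s + 1) - 1 = -(s / (s + 1)) := by field_simp; ring
  rw [h, abs_neg, abs_of_pos (by positivity)]
  field_simp
  ring

/-- A run of digits `2`, along an orbit that starts close to `-1`. -/
theorem iterate_T_one_div_sub_one (h0 : 0 < α) (ht : α * (t - 1) ≤ 1) (i : ℕ)
    (hi : 1 < (1 + α) * (t - i)) :
    (T α)^[i] (1 / t - 1) = 1 / (t - i) - 1 ∧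
      cfMatrix α (1 / t - 1) i = !![1 - (i : ℤ), -i; i, i + 1] := by
  induction i with
  | zero => simp [cfMatrix_zero, Matrix.one_fin_two]
  | succ i ih =>
    set s := t - (i + 1 : ℕ) with hs
    have hs' : t - i = s + 1 := by rw [hs]; push_cast; ring
    have hpos : 0 < s := pos_of_mul_pos_right (one_pos.trans hi) (by linarith)
    obtain ⟨horbit, hmatrix⟩ := ih (by rw [hs']; nlinarith)
    rw [hs'] at horbit
    have hneg : 1 / (s + 1) - 1 < 0 := by rw [sub_neg, div_lt_one (by linarith)]; linarith
    have hdiff : 1 / |1 / (s + 1) - 1| - ((2 : ℤ) : ℝ) = 1 / s - 1 := by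
      rw [abs_one_div_add_one_sub_one hpos]; push_cast; ring
    have hmem : 1 / |1 / (s + 1) - 1| - ((2 : ℤ) : ℝ) ∈ Ico (α - 1) α := by
      rw [hdiff]
      constructor
      · have : α ≤ 1 / s := by
          rw [le_div_iff₀ hpos]
          have : s ≤ t - 1 := by rw [hs]; push_cast; linarith [(Nat.cast_nonneg i : (0 : ℝ) ≤ i)]
          nlinarith
        linarith
      · linarith [(div_lt_iff₀ hpos).mpr hi]
    refine ⟨?_, ?_⟩
    · rw [Function.iterate_succ_apply', horbit, T_eq_of_sub_mem_Ico hneg.ne hmem, hdiff]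
    · rw [cfMatrix_succ, horbit, digit_eq_of_sub_mem_Ico hmem, eps_of_neg hneg, hmatrix]
      simp only [Matrix.mul_fin_two]
      push_cast
      ring_nf

theorem iterate_T_one_div_sub_one_ne_zero (h0 : 0 < α) (ht : α * (t - 1) ≤ 1) {i : ℕ}
    (hi : 1 < t - i) : (T α)^[i] (1 / t - 1) ≠ 0 := by
  rw [(iterate_T_one_div_sub_one h0 ht i (by nlinarith)).1, sub_ne_zero]
  exact ((div_lt_one (by linarith)).mpr hi).ne

theorem digit_eq_one_div_sub (hA : 0 < A) : (digit α A : ℝ) = 1 / A - T α A := by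
  rw [T_of_ne_zero hA.ne', abs_of_pos hA, sub_sub_cancel]

theorem PairMatching.of_le_T (h0 : 0 < α) (hA : 0 < A) (ht : α * (1 / A - 1) ≤ 1) {c : ℕ}
    (hc : digit α A = c + 2) (hT : 1 < (1 + α) * (T α A + 1)) : PairMatching α A 1 (c + 1) := by
  have hdigit := digit_eq_one_div_sub (α := α) hA
  rw [hc] at hdigit
  push_cast at hdigit
  have hstart : A - 1 = 1 / (1 / A) - 1 := by rw [one_div_one_div]
  refine ⟨fun i hi => ?_, fun i hi => ?_, ?_⟩
  · rw [Nat.lt_one_iff.mp hi]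
    exact hA.ne'
  · have hic : (i : ℝ) ≤ c := by exact_mod_cast Nat.lt_succ_iff.mp hi
    rw [hstart]
    exact iterate_T_one_div_sub_one_ne_zero h0 ht (by linarith [(T_mem_Ico (α := α) hA.ne').1])
  · have hrun : 1 < (1 + α) * (1 / A - (c + 1 : ℕ)) := by
      convert hT using 2
      push_cast
      linarith
    rw [cfMatrix_one, hc, eps_of_pos hA, hstart, (iterate_T_one_div_sub_one h0 ht _ hrun).2]
    simp only [Matrix.mul_fin_two]
    push_cast
    ring_nf

/-- After the run of digits `2` of `A - 1`, the two orbits go on like those of `A'` and `A' - 1`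
with `A' = -T_α A`, up to an integer translation of `1 / |x|`. -/
theorem PairMatching.of_T_neg (h : PairMatching α (-T α A) (n + 1) (m + 1)) (h0 : 0 < α)
    (hA : 0 < A) (ht : α * (1 / A - 1) ≤ 1) {c : ℕ} (hc : digit α A = c + 2) (hT : T α A < 0) :
    PairMatching α A (1 + (n + 1)) (c + (m + 1)) := by
  obtain ⟨hn, hm, hM⟩ := h
  have hdigit := digit_eq_one_div_sub (α := α) hA
  rw [hc] at hdigit
  push_cast at hdigit
  have ha1 := (T_mem_Ico (α := α) hA.ne').1
  have hstart : A - 1 = 1 / (1 / A) - 1 := by rw [one_div_one_div]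
  have hsub : 1 / A - c = (T α A + 1) + 1 := by linarith
  obtain ⟨horbit, hmatrix⟩ :=
    iterate_T_one_div_sub_one (i := c) h0 ht (by rw [hsub]; nlinarith)
  rw [hsub, ← hstart] at horbit
  rw [← hstart] at hmatrix
  set a := T α A
  set b := 1 / (a + 1 + 1) - 1
  have hb : b < 0 := by rw [sub_neg, div_lt_one (by linarith)]; linarith
  have hb' : -a - 1 < 0 := by linarith
  have hbabs : 1 / |b| = 1 / |-a - 1| + (1 : ℤ) := by
    rw [abs_one_div_add_one_sub_one (by linarith), abs_of_neg hb']
    push_cast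
    ring_nf
  refine ⟨iterate_T_ne_zero_of_add ?_ ?_, iterate_T_ne_zero_of_add ?_ ?_, ?_⟩
  · intro i hi
    rw [Nat.lt_one_iff.mp hi]
    exact hA.ne'
  · exact iterate_T_ne_zero_of_succ_eq hT.ne hn (iterate_T_neg hT.ne 0).symm
  · intro i hi
    rw [hstart]
    have : (i : ℝ) ≤ c := by exact_mod_cast hi.le
    exact iterate_T_one_div_sub_one_ne_zero h0 ht (by linarith)
  · rw [horbit]
    exact iterate_T_ne_zero_of_succ_eq hb.ne hm (T_eq_T_of_one_div_abs hb.ne hb'.ne hbabs)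
  · have hneg : cfMatrix α a (n + 1) = !![-1, 0; 0, 1] * cfMatrix α (-a) (n + 1) := by
      rw [← cfMatrix_neg_succ (neg_ne_zero.mpr hT.ne), neg_neg]
    rw [cfMatrix_add α A 1, cfMatrix_add α (A - 1) c, Function.iterate_one, horbit, hmatrix,
      cfMatrix_one, hc, cfMatrix_succ_eq_mul hb.ne hb'.ne hbabs, hneg, hM, eps_of_neg hb,
      eps_of_neg hb', eps_of_pos hA]
    simp only [← mul_assoc, Matrix.mul_fin_two]
    push_cast
    ring_nf

theorem exists_pairMatching_of_le_half {r : ℚ} (h0 : 0 < α) (hl : α / (1 + α) ≤ r)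
    (hhalf : (r : ℝ) ≤ 1 / 2)
    (ih : ∀ s : ℚ, s.den < r.den → α / (1 + α) ≤ s → (s : ℝ) ≤ 1 / (1 + α) →
      ∃ n m, PairMatching α s (n + 1) (m + 1)) :
    ∃ n m, PairMatching α r (n + 1) (m + 1) := by
  have hr : 0 < (r : ℝ) := lt_of_lt_of_le (by positivity) hl
  have hr0 : r ≠ 0 := by rintro rfl; simp at hr
  have hmem := T_mem_Ico (α := α) hr.ne'
  have hl' : α * (1 - r) ≤ r := by rw [div_le_iff₀ (by linarith)] at hl; linarith
  have hα : α ≤ 1 := by nlinarith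
  have ht : α * (1 / (r : ℝ) - 1) ≤ 1 := by
    rwa [one_div, ← mul_le_mul_iff_of_pos_right hr, mul_assoc, sub_mul, inv_mul_cancel₀ hr.ne',
      one_mul]
  have ht2 : 2 ≤ 1 / (r : ℝ) := by rw [le_div_iff₀ hr]; linarith
  have hdigit := digit_eq_one_div_sub (α := α) hr
  obtain ⟨c, hc⟩ : ∃ c : ℕ, digit α r = c + 2 := by
    have : (1 : ℝ) < digit α r := by linarith [hmem.2]
    have : 1 < digit α r := by exact_mod_cast this
    exact ⟨(digit α r - 2).toNat, by omega⟩
  rcases lt_or_ge 1 ((1 + α) * (T α r + 1)) with hT | hT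
  · exact ⟨0, c, .of_le_T h0 hr ht hc hT⟩
  have hneg : T α r < 0 := by nlinarith
  have hcast : ((-ratT α r : ℚ) : ℝ) = -T α r := by rw [Rat.cast_neg, semiconj_ratT]
  obtain ⟨n, m, hnm⟩ := ih (-ratT α r)
    (by simpa using den_ratT_lt hr0 (by rw [abs_of_pos hr]; linarith))
    (by rw [hcast, div_le_iff₀ (by linarith)]; linarith)
    (by rw [hcast, le_div_iff₀ (by linarith)]; nlinarith [hmem.1])
  rw [hcast] at hnm
  exact ⟨1 + n, c + m, by simpa only [add_assoc] using hnm.of_T_neg h0 hr ht hc hneg⟩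

theorem exists_pairMatching (h0 : 0 < α) (r : ℚ) (hl : α / (1 + α) ≤ r) (hu : r ≤ 1 / (1 + α)) :
    ∃ n m, PairMatching α r (n + 1) (m + 1) := by
  induction hd : r.den using Nat.strong_induction_on generalizing r with
  | _ d ih =>
  subst hd
  rcases le_total (r : ℝ) (1 / 2) with hr | hr
  · exact exists_pairMatching_of_le_half h0 hl hr fun s hs hl hu => ih _ hs s hl hu rfl
  have hden : (1 - r).den = r.den := Rat.intCast_sub_den 1 r
  have hsum : α / (1 + α) = 1 - 1 / (1 + α) := by field_simp; ring
  obtain ⟨n, m, h⟩ := exists_pairMatching_of_le_half (r := 1 - r) h0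
    (by push_cast; linarith) (by push_cast; linarith)
    fun s hs hl hu => ih _ (hden ▸ hs) s hl hu rfl
  refine ⟨m, n, ?_⟩
  simpa using h.symm

theorem algMatching_one_zero (h0 : 0 < α) (h1 : α ≤ 1) (h : 1 < (1 + α) * α) :
    AlgMatching 1 0 α := by
  have hd : digit α α = 1 := by
    refine digit_eq_of_sub_mem_Ico ⟨?_, ?_⟩ <;> rw [abs_of_pos h0] <;> push_cast
    · linarith [(one_le_div h0).mpr h1]
    · linarith [(div_lt_iff₀ h0).mpr h]
  refine ⟨fun i hi => ?_, fun i hi => (Nat.not_lt_zero i hi).elim, ?_⟩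
  · rw [Nat.lt_one_iff.mp hi]
    exact h0.ne'
  · rw [cfMatrix_one, cfMatrix_zero, hd, eps_of_pos h0]
    decide

theorem exists_algMatching {a : ℚ} (h0 : 0 < (a : ℝ)) (h1 : (a : ℝ) < 1) :
    ∃ n m, AlgMatching n m a := by
  rcases lt_or_ge 1 ((1 + (a : ℝ)) * a) with h | h
  · exact ⟨1, 0, algMatching_one_zero h0 h1.le h⟩
  · obtain ⟨n, m, hnm⟩ := exists_pairMatching h0 a
      (by rw [div_le_iff₀ (by linarith)]; nlinarith)
      (by rw [le_div_iff₀ (by linarith)]; linarith)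
    exact ⟨n + 1, m + 1, hnm⟩

end Existence

section LocalConstancy

variable {α : ℝ} {f : ℝ → ℝ}

theorem eventually_digit_eq (hf : ContinuousAt f α) (hα : f α ≠ 0) (hT : T α (f α) ≠ α - 1) :
    ∀ᶠ y in 𝓝 α, digit y (f y) = digit α (f α) := by
  have hcont : ContinuousAt (fun y => 1 / |f y| + 1 - y) α :=
    ((continuousAt_const.div hf.abs (abs_ne_zero.mpr hα)).add continuousAt_const).sub
      continuousAt_id
  have hlower : (digit α (f α) : ℝ) < 1 / |f α| + 1 - α := by
    refine lt_of_le_of_ne (Int.floor_le _) fun h => hT ?_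
    rw [T_of_ne_zero hα, h]
    ring
  have hupper : 1 / |f α| + 1 - α < digit α (f α) + 1 := Int.lt_floor_add_one _
  filter_upwards [hcont.eventually (lt_mem_nhds hlower), hcont.eventually (gt_mem_nhds hupper)]
    with y h h'
  exact Int.floor_eq_iff.mpr ⟨h.le, h'⟩

theorem eventually_eps_eq (hf : ContinuousAt f α) (hα : f α ≠ 0) :
    ∀ᶠ y in 𝓝 α, eps (f y) = eps (f α) := by
  rcases hα.lt_or_gt with h | h
  · filter_upwards [hf.eventually (gt_mem_nhds h)] with y hy
    rw [eps_of_neg h, eps_of_neg hy]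
  · filter_upwards [hf.eventually (lt_mem_nhds h)] with y hy
    rw [eps_of_pos h, eps_of_pos hy]

theorem continuousAt_T (hf : ContinuousAt f α) (hα : f α ≠ 0) (hT : T α (f α) ≠ α - 1) :
    ContinuousAt (fun y => T y (f y)) α := by
  have : ContinuousAt (fun y => 1 / |f y| - (digit α (f α) : ℝ)) α :=
    (continuousAt_const.div hf.abs (abs_ne_zero.mpr hα)).sub continuousAt_const
  refine this.congr ?_
  filter_upwards [eventually_digit_eq hf hα hT, hf.eventually_ne hα] with y hy hy'
  rw [T_of_ne_zero hy', hy]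

theorem continuousAt_iterate_T {n : ℕ} (hf : ContinuousAt f α)
    (h0 : ∀ i < n, (T α)^[i] (f α) ≠ 0) (h1 : ∀ i < n, (T α)^[i + 1] (f α) ≠ α - 1) :
    ContinuousAt (fun y => (T y)^[n] (f y)) α := by
  induction n with
  | zero => exact hf
  | succ n ih =>
    have hT := h1 n n.lt_succ_self
    simp only [Function.iterate_succ_apply'] at hT ⊢
    exact continuousAt_T (ih (fun i hi => h0 i (by omega)) fun i hi => h1 i (by omega))
      (h0 n n.lt_succ_self) hT

theorem eventually_cfMatrix_eq {n : ℕ} (hf : ContinuousAt f α)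
    (h0 : ∀ i < n, (T α)^[i] (f α) ≠ 0) (h1 : ∀ i < n, (T α)^[i + 1] (f α) ≠ α - 1) :
    ∀ᶠ y in 𝓝 α, (∀ i < n, (T y)^[i] (f y) ≠ 0) ∧ cfMatrix y (f y) n = cfMatrix α (f α) n := by
  induction n with
  | zero => exact .of_forall fun y => ⟨fun i hi => (Nat.not_lt_zero i hi).elim, rfl⟩
  | succ n ih =>
    have h0' : ∀ i < n, (T α)^[i] (f α) ≠ 0 := fun i hi => h0 i (by omega)
    have h1' : ∀ i < n, (T α)^[i + 1] (f α) ≠ α - 1 := fun i hi => h1 i (by omega)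
    have hn := h0 n n.lt_succ_self
    have hcont := continuousAt_iterate_T hf h0' h1'
    filter_upwards [ih h0' h1', hcont.eventually_ne hn, eventually_eps_eq hcont hn,
      eventually_digit_eq hcont hn (Function.iterate_succ_apply' (T α) n _ ▸ h1 n n.lt_succ_self)]
      with y ⟨hne, hM⟩ hy hε hd
    refine ⟨fun i hi => ?_, ?_⟩
    · rcases Nat.lt_succ_iff_lt_or_eq.mp hi with h | rfl
      exacts [hne i h, hy]
    · rw [cfMatrix_succ, cfMatrix_succ, hM, hε, hd]

end LocalConstancy

section MatchingIntervals

variable {α : ℝ} {a : ℚ} {n m n₀ m₀ : ℕ}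

theorem AlgMatching.eventually (h : AlgMatching n m a) (h0 : 0 < (a : ℝ)) (h1 : (a : ℝ) < 1) :
    ∀ᶠ y in 𝓝 (a : ℝ), AlgMatching n m y := by
  obtain ⟨hn, hm, hM⟩ := h
  have ha (i : ℕ) : (T a)^[i + 1] (a : ℝ) ≠ a - 1 :=
    iterate_T_ne_sub_one h0 h1 (abs_lt.mpr ⟨by linarith, h1⟩) rfl i
  have ha' (i : ℕ) : (T a)^[i + 1] ((a : ℝ) - 1) ≠ a - 1 := by
    have := iterate_T_ne_sub_one (r := a - 1) h0 h1
      (by rw [abs_lt]; push_cast; constructor <;> linarith) (Rat.sub_intCast_den a 1) i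
    exact_mod_cast this
  filter_upwards [eventually_cfMatrix_eq (f := fun y => y) continuousAt_id hn fun i _ => ha i,
    eventually_cfMatrix_eq (f := fun y => y - 1) (continuousAt_id.sub continuousAt_const) hm
      fun i _ => ha' i] with y ⟨hyn, hyM⟩ ⟨hym, hyM'⟩
  exact ⟨hyn, hym, by rw [hyM, hyM', hM]⟩

theorem exists_mem_matchingInterior (h0 : 0 < (a : ℝ)) (h1 : (a : ℝ) ≤ 1) :
    ∃ n m, (a : ℝ) ∈ matchingInterior n m := by
  rcases h1.lt_or_eq with h1 | h1
  · obtain ⟨n, m, h⟩ := exists_algMatching h0 h1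
    exact ⟨n, m, ⟨h0, h1.le⟩, (h.eventually h0 h1).filter_mono nhdsWithin_le_nhds⟩
  · have hcont : ContinuousAt (fun y : ℝ => (1 + y) * y) a := by fun_prop
    have hlt := hcont.eventually (lt_mem_nhds (a := 1) (by rw [h1]; norm_num))
    refine ⟨1, 0, ⟨h0, h1.le⟩, ?_⟩
    filter_upwards [self_mem_nhdsWithin, nhdsWithin_le_nhds hlt] with y hy hylt
    exact algMatching_one_zero hy.1 hy.2 hylt

theorem algMatching_of_mem_matchingInterior (h : α ∈ matchingInterior n m) : AlgMatching n m α :=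
  h.2.self_of_nhdsWithin h.1

theorem IsMatchingInterval.subset_Ioc {J : Set ℝ} (hJ : IsMatchingInterval n m J) :
    J ⊆ Ioc 0 1 := by
  obtain ⟨x, -, rfl⟩ := hJ
  exact fun y hy => (connectedComponentIn_subset _ _ hy).1

theorem IsMatchingInterval.algMatching {J : Set ℝ} (hJ : IsMatchingInterval n m J) (h : α ∈ J) :
    AlgMatching n m α := by
  obtain ⟨x, -, rfl⟩ := hJ
  exact algMatching_of_mem_matchingInterior (connectedComponentIn_subset _ _ h)

theorem InEvenMatchingInterval.even (h : InEvenMatchingInterval α) (hn : FirstZero α α n₀)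
    (hm : FirstZero α (α - 1) m₀) : Even ((m₀ : ℤ) - n₀) := by
  obtain ⟨J, n, m, hJ, hα, he⟩ := h
  rwa [← (hJ.algMatching hα).index_eq hn hm]

theorem InOddMatchingInterval.odd (h : InOddMatchingInterval α) (hn : FirstZero α α n₀)
    (hm : FirstZero α (α - 1) m₀) : Odd ((m₀ : ℤ) - n₀) := by
  obtain ⟨J, n, m, hJ, hα, ho⟩ := h
  rwa [← (hJ.algMatching hα).index_eq hn hm]

theorem inEvenMatchingInterval_iff (h0 : 0 < (a : ℝ)) (h1 : (a : ℝ) ≤ 1)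
    (hn : FirstZero a a n₀) (hm : FirstZero a (a - 1) m₀) :
    InEvenMatchingInterval a ↔ Even ((m₀ : ℤ) - n₀) := by
  refine ⟨fun h => h.even hn hm, fun he => ?_⟩
  obtain ⟨n, m, h⟩ := exists_mem_matchingInterior h0 h1
  refine ⟨_, n, m, ⟨a, h, rfl⟩, mem_connectedComponentIn h, ?_⟩
  rwa [(algMatching_of_mem_matchingInterior h).index_eq hn hm]

end MatchingIntervals

/-! ### One-sided averages -/

section Averages

variable {f g p q : ℝ → ℝ}

/-- The averages of `f` over `[0, h]` tend to `+∞` as `h` decreases to `0`. Integrability near `0`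
is part of the definition, since the integrals would otherwise take the junk value `0`. -/
structure AvgAtTop (f : ℝ → ℝ) : Prop where
  integrable : IntegrableAtFilter f (𝓝[>] 0)
  tendsto : Tendsto (fun h => h⁻¹ * ∫ u in (0 : ℝ)..h, f u) (𝓝[>] 0) atTop

theorem integrableAtFilter_nhdsGT_iff :
    IntegrableAtFilter f (𝓝[>] 0) ↔ ∀ᶠ h in 𝓝[>] 0, IntervalIntegrable f volume 0 h := by
  constructor
  · rintro ⟨s, hs, hf⟩
    obtain ⟨δ, hδ, hsub⟩ := mem_nhdsGT_iff_exists_Ioc_subset.mp hs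
    filter_upwards [Ioo_mem_nhdsGT hδ] with h hh
    exact (intervalIntegrable_iff_integrableOn_Ioc_of_le hh.1.le).mpr
      (hf.mono_set ((Ioc_subset_Ioc_right hh.2.le).trans hsub))
  · intro h
    obtain ⟨δ, hδ, hpos⟩ := (h.and self_mem_nhdsWithin).exists
    exact ⟨Ioc 0 δ, Ioc_mem_nhdsGT hpos,
      (intervalIntegrable_iff_integrableOn_Ioc_of_le (le_of_lt hpos)).mp hδ⟩

theorem AvgAtTop.not_neg (hf : AvgAtTop f) : ¬ AvgAtTop (-f) := by
  intro hf'
  obtain ⟨h, hpos, hneg⟩ :=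
    ((hf.tendsto.eventually_gt_atTop 0).and (hf'.tendsto.eventually_gt_atTop 0)).exists
  simp only [Pi.neg_apply, intervalIntegral.integral_neg] at hneg
  linarith

theorem AvgAtTop.congr (hf : AvgAtTop f) (h : f =ᶠ[𝓝[>] 0 ⊓ ae volume] g) : AvgAtTop g := by
  obtain ⟨s, hs, t, ht, hst⟩ := mem_inf_iff.mp h
  obtain ⟨δ, hδ, hsub⟩ := mem_nhdsGT_iff_exists_Ioc_subset.mp hs
  have heq : ∀ h ∈ Ioo 0 δ, ∀ᵐ u, u ∈ uIoc 0 h → f u = g u := by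
    intro h hh
    filter_upwards [ht] with u hut hu
    rw [uIoc_of_le hh.1.le] at hu
    exact hst.ge ⟨hsub ⟨hu.1, hu.2.trans hh.2.le⟩, hut⟩
  refine ⟨?_, hf.tendsto.congr' ?_⟩
  · rw [integrableAtFilter_nhdsGT_iff]
    filter_upwards [integrableAtFilter_nhdsGT_iff.mp hf.integrable, Ioo_mem_nhdsGT hδ]
      with h hi hh
    exact hi.congr_ae ((ae_restrict_iff' measurableSet_uIoc).mpr (heq h hh))
  · filter_upwards [Ioo_mem_nhdsGT hδ] with h hh
    rw [intervalIntegral.integral_congr_ae (heq h hh)]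

theorem AvgAtTop.congr' (hf : AvgAtTop f) (h : f =ᶠ[𝓝[>] 0] g) : AvgAtTop g :=
  hf.congr (h.filter_mono inf_le_left)

theorem AvgAtTop.const_mul {c : ℝ} (hf : AvgAtTop f) (hc : 0 < c) :
    AvgAtTop fun u => c * f u := by
  refine ⟨hf.integrable.smul c, (hf.tendsto.const_mul_atTop hc).congr fun h => ?_⟩
  rw [intervalIntegral.integral_const_mul, mul_left_comm]

theorem AvgAtTop.add {K : ℝ} (hf : AvgAtTop f) (hg : IntegrableAtFilter g (𝓝[>] 0))
    (hK : ∀ᶠ h in 𝓝[>] 0, |∫ u in (0 : ℝ)..h, g u| ≤ K * h) : AvgAtTop (f + g) := by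
  refine ⟨hf.integrable.add hg,
    tendsto_atTop_mono' _ ?_ (tendsto_atTop_add_const_right _ (-K) hf.tendsto)⟩
  filter_upwards [integrableAtFilter_nhdsGT_iff.mp hf.integrable,
    integrableAtFilter_nhdsGT_iff.mp hg, hK, self_mem_nhdsWithin] with h hfi hgi hKh hpos
  have hK' : -K ≤ h⁻¹ * ∫ u in (0 : ℝ)..h, g u := by
    rw [le_inv_mul_iff₀ hpos]
    linarith [(abs_le.mp hKh).1]
  simp only [Pi.add_apply]
  rw [intervalIntegral.integral_add hfi hgi, mul_add]
  gcongr

theorem AvgAtTop.of_abs_sub_le {C : ℝ} (hf : AvgAtTop f) (hg : Measurable g)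
    (hC : ∀ᶠ u in 𝓝[>] 0, |f u - g u| ≤ C) : AvgAtTop g := by
  have hgf : ∀ᶠ u in 𝓝[>] 0, ‖g u - f u‖ ≤ C := hC.mono fun u hu => by rwa [norm_sub_rev]
  have hfm : StronglyMeasurableAtFilter f (𝓝[>] 0) := by
    obtain ⟨s, hs, hfs⟩ := hf.integrable
    exact ⟨s, hs, hfs.aestronglyMeasurable⟩
  have hm : StronglyMeasurableAtFilter (g - f) (𝓝[>] 0) := by
    obtain ⟨s, hs, hfs⟩ := hfm
    exact ⟨s, hs, hg.aestronglyMeasurable.sub hfs⟩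
  have hint : IntegrableAtFilter (g - f) (𝓝[>] 0) :=
    ((volume.finiteAt_nhds 0).filter_mono nhdsWithin_le_nhds).integrableAtFilter hm
      (isBoundedUnder_of_eventually_le hgf)
  refine (hf.add hint (K := C) ?_).congr' (.of_forall fun u => add_sub_cancel (f u) (g u))
  obtain ⟨δ, hδ, hsub⟩ := mem_nhdsGT_iff_exists_Ioc_subset.mp hgf
  filter_upwards [Ioo_mem_nhdsGT hδ] with h hh
  have := intervalIntegral.norm_integral_le_of_norm_le_const (a := 0) (b := h) (C := C)
    (f := g - f) fun u hu => by
      rw [uIoc_of_le hh.1.le] at hu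
      exact hsub ⟨hu.1, hu.2.trans hh.2.le⟩
  rwa [sub_zero, abs_of_pos hh.1] at this

theorem avgAtTop_iff_of_abs_sub_le {C : ℝ} (hf : Measurable f) (hg : Measurable g)
    (hC : ∀ᶠ u in 𝓝[>] 0, |f u - g u| ≤ C) : AvgAtTop f ↔ AvgAtTop g :=
  ⟨fun h => h.of_abs_sub_le hg hC,
    fun h => h.of_abs_sub_le hf (hC.mono fun u hu => by rwa [abs_sub_comm])⟩

theorem AvgAtTop.add_mul (hf : AvgAtTop f) (hp : Measurable p) (hpO : p =O[𝓝[>] 0] id)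
    (hq : IntegrableAtFilter q (𝓝[>] 0)) : AvgAtTop (f + p * q) := by
  obtain ⟨C, hC, hpC⟩ := hpO.exists_pos
  obtain ⟨δ, hδ, hsub⟩ := mem_nhdsGT_iff_exists_Ioc_subset.mp hpC.bound
  obtain ⟨δ', ⟨hqδ, hδ'⟩⟩ :=
    ((integrableAtFilter_nhdsGT_iff.mp hq).and (Ioo_mem_nhdsGT hδ)).exists
  rw [intervalIntegrable_iff_integrableOn_Ioc_of_le hδ'.1.le] at hqδ
  have hle : ∀ h ∈ Ioc 0 δ', ∀ u ∈ Ioc 0 h, ‖p u‖ ≤ C * h := by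
    intro h hh u hu
    refine (hsub ⟨hu.1, hu.2.trans (hh.2.trans hδ'.2.le)⟩ : ‖p u‖ ≤ C * ‖id u‖).trans ?_
    rw [id, Real.norm_of_nonneg hu.1.le]
    exact mul_le_mul_of_nonneg_left hu.2 hC.le
  have hint : IntegrableOn (p * q) (Ioc 0 δ') :=
    hqδ.bdd_mul hp.aestronglyMeasurable
      ((ae_restrict_iff' measurableSet_Ioc).mpr
        (.of_forall (hle δ' ⟨hδ'.1, le_rfl⟩)))
  refine hf.add ⟨_, Ioc_mem_nhdsGT hδ'.1, hint⟩ (K := C * ∫ u in Ioc 0 δ', ‖q u‖) ?_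
  filter_upwards [Ioo_mem_nhdsGT hδ'.1] with h hh
  have hsub' : Ioc 0 h ⊆ Ioc 0 δ' := Ioc_subset_Ioc_right hh.2.le
  rw [intervalIntegral.integral_of_le hh.1.le]
  calc |∫ u in Ioc 0 h, (p * q) u|
      ≤ ∫ u in Ioc 0 h, C * h * ‖q u‖ := by
        rw [← Real.norm_eq_abs]
        refine norm_integral_le_of_norm_le ((hqδ.mono_set hsub').norm.const_mul _)
          ((ae_restrict_iff' measurableSet_Ioc).mpr (.of_forall fun u hu => ?_))
        rw [Pi.mul_apply, norm_mul]
        gcongr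
        exact hle h ⟨hh.1, hh.2.le⟩ u hu
    _ = C * h * ∫ u in Ioc 0 h, ‖q u‖ := integral_const_mul _ _
    _ ≤ C * h * ∫ u in Ioc 0 δ', ‖q u‖ := by
        have := hh.1
        gcongr
        · exact .of_forall fun u => norm_nonneg _
        · exact hqδ.norm
    _ = (C * ∫ u in Ioc 0 δ', ‖q u‖) * h := by ring

theorem AvgAtTop.mul (hf : AvgAtTop f) (hq : Measurable q) (hd : DifferentiableAt ℝ q 0)
    (hq0 : 0 < q 0) : AvgAtTop (q * f) := by
  have hO : (fun u => q u - q 0) =O[𝓝[>] 0] id := by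
    simpa only [sub_zero] using! hd.isBigO_sub.mono nhdsWithin_le_nhds
  refine ((hf.const_mul hq0).add_mul (hq.sub_const _) hO hf.integrable).congr'
    (.of_forall fun u => ?_)
  simp only [Pi.add_apply, Pi.mul_apply]
  ring

theorem avgAtTop_mul_iff (hq : Measurable q) (hd : DifferentiableAt ℝ q 0) (hq0 : 0 < q 0) :
    AvgAtTop (q * f) ↔ AvgAtTop f := by
  refine ⟨fun h => ?_, fun h => h.mul hq hd hq0⟩
  refine (h.mul hq.inv (hd.inv hq0.ne') (inv_pos.mpr hq0)).congr' ?_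
  filter_upwards [nhdsWithin_le_nhds (hd.continuousAt.eventually_ne hq0.ne')] with u hu
  exact inv_mul_cancel_left₀ hu (f u)

end Averages

section Substitution

variable {g φ φ' : ℝ → ℝ}

theorem eventually_strictMonoOn_Icc (hφ : ∀ᶠ u in 𝓝 0, HasDerivAt φ (φ' u) u ∧ 0 < φ' u) :
    ∀ᶠ h in 𝓝[>] 0, (∀ u ∈ Icc 0 h, HasDerivAt φ (φ' u) u ∧ 0 < φ' u) ∧
      StrictMonoOn φ (Icc 0 h) := by
  obtain ⟨δ, hδ, hball⟩ := Metric.eventually_nhds_iff.mp hφ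
  filter_upwards [Ioo_mem_nhdsGT hδ] with h hh
  have hderiv : ∀ u ∈ Icc 0 h, HasDerivAt φ (φ' u) u ∧ 0 < φ' u := by
    intro u hu
    refine hball ?_
    rw [Real.dist_0_eq_abs, abs_of_nonneg hu.1]
    exact hu.2.trans_lt hh.2
  refine ⟨hderiv, strictMonoOn_of_deriv_pos (convex_Icc 0 h)
    (fun u hu => (hderiv u hu).1.continuousAt.continuousWithinAt) fun u hu => ?_⟩
  obtain ⟨hd, hpos⟩ := hderiv u (interior_subset hu)
  rwa [hd.deriv]

theorem map_nhdsGT_zero (hφ0 : φ 0 = 0)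
    (hφ : ∀ᶠ u in 𝓝 0, HasDerivAt φ (φ' u) u ∧ 0 < φ' u) : map φ (𝓝[>] 0) = 𝓝[>] 0 := by
  have hmono := eventually_strictMonoOn_Icc hφ
  refine le_antisymm (tendsto_nhdsWithin_iff.mpr ⟨?_, ?_⟩) fun s hs => ?_
  · have hcont := hφ.self_of_nhds.1.continuousAt.tendsto
    rw [hφ0] at hcont
    exact hcont.mono_left nhdsWithin_le_nhds
  · filter_upwards [hmono, self_mem_nhdsWithin] with h hh hpos
    exact hφ0 ▸ hh.2 ⟨le_rfl, le_of_lt hpos⟩ ⟨le_of_lt hpos, le_rfl⟩ hpos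
  · obtain ⟨δ, hδ, hsub⟩ := mem_nhdsGT_iff_exists_Ioc_subset.mp hs
    obtain ⟨h, ⟨hderiv, hh⟩, hpos, hle⟩ := (hmono.and (Ioo_mem_nhdsGT hδ)).exists
    have hφh : φ 0 < φ h := hh ⟨le_rfl, hpos.le⟩ ⟨hpos.le, le_rfl⟩ hpos
    have hivt := intermediate_value_Ioc hpos.le
      fun u hu => (hderiv u hu).1.continuousAt.continuousWithinAt
    rw [hφ0] at hφh hivt
    filter_upwards [Ioc_mem_nhdsGT hφh] with v hv
    obtain ⟨u, hu, rfl⟩ := hivt hv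
    exact hsub ⟨hu.1, hu.2.trans hle.le⟩

theorem tendsto_mul_atTop_iff_of_pos {ι : Type*} {l : Filter ι} {r F : ι → ℝ} {c : ℝ}
    (hc : 0 < c) (hr : Tendsto r l (𝓝 c)) :
    Tendsto (fun i => r i * F i) l atTop ↔ Tendsto F l atTop := by
  refine ⟨fun h => ?_, fun h => hr.pos_mul_atTop hc h⟩
  refine ((hr.inv₀ hc.ne').pos_mul_atTop (inv_pos.mpr hc) h).congr' ?_
  filter_upwards [hr.eventually_ne hc.ne'] with i hi
  exact inv_mul_cancel_left₀ hi (F i)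

theorem eventually_intervalIntegral_deriv_mul_comp (hφ0 : φ 0 = 0)
    (hφ : ∀ᶠ u in 𝓝 0, HasDerivAt φ (φ' u) u ∧ 0 < φ' u) : ∀ᶠ h in 𝓝[>] 0,
      (IntervalIntegrable (fun u => φ' u * g (φ u)) volume 0 h ↔
        IntervalIntegrable g volume 0 (φ h)) ∧
      ∫ u in (0 : ℝ)..h, φ' u * g (φ u) = ∫ v in (0 : ℝ)..φ h, g v := by
  filter_upwards [eventually_strictMonoOn_Icc hφ, self_mem_nhdsWithin] with h hh hpos
  have hcont : ContinuousOn φ (uIcc 0 h) := by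
    rw [uIcc_of_le (le_of_lt hpos)]
    exact fun u hu => (hh.1 u hu).1.continuousAt.continuousWithinAt
  have hderiv : ∀ u ∈ Ioo (min 0 h) (max 0 h), HasDerivAt φ (φ' u) u ∧ 0 < φ' u := by
    rw [min_eq_left (le_of_lt hpos), max_eq_right (le_of_lt hpos)]
    exact fun u hu => hh.1 u (Ioo_subset_Icc_self hu)
  have hnn := fun u hu => (hderiv u hu).2.le
  constructor
  · have := intervalIntegral.integrable_deriv_smul_comp_iff_of_deriv_nonneg (g := g) hcont
      (fun u hu => (hderiv u hu).1) hnn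
    rwa [hφ0] at this
  · have := intervalIntegral.integral_deriv_smul_comp_of_deriv_nonneg (g := g) hcont
      (fun u hu => (hderiv u hu).1) hnn
    rwa [hφ0] at this

theorem avgAtTop_deriv_mul_comp_iff (hφ0 : φ 0 = 0)
    (hφ : ∀ᶠ u in 𝓝 0, HasDerivAt φ (φ' u) u ∧ 0 < φ' u) :
    AvgAtTop (fun u => φ' u * g (φ u)) ↔ AvgAtTop g := by
  have hmap := map_nhdsGT_zero hφ0 hφ
  have hint : IntegrableAtFilter (fun u => φ' u * g (φ u)) (𝓝[>] 0) ↔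
      IntegrableAtFilter g (𝓝[>] 0) := by
    rw [integrableAtFilter_nhdsGT_iff, integrableAtFilter_nhdsGT_iff]
    conv_rhs => rw [← hmap, eventually_map]
    refine eventually_congr ?_
    filter_upwards [eventually_intervalIntegral_deriv_mul_comp (g := g) hφ0 hφ] with h hh
    exact hh.1
  have hslope : Tendsto (fun h => h⁻¹ * φ h) (𝓝[>] 0) (𝓝 (φ' 0)) := by
    simpa only [zero_add, hφ0, sub_zero, smul_eq_mul] using!
      (hasDerivAt_iff_tendsto_slope_zero.mp hφ.self_of_nhds.1).mono_left (nhdsGT_le_nhdsNE 0)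
  have htop : Tendsto (fun h => h⁻¹ * ∫ u in (0 : ℝ)..h, φ' u * g (φ u)) (𝓝[>] 0) atTop ↔
      Tendsto (fun h => h⁻¹ * ∫ u in (0 : ℝ)..h, g u) (𝓝[>] 0) atTop := by
    conv_rhs => rw [← hmap, tendsto_map'_iff]
    refine .trans ?_ (tendsto_mul_atTop_iff_of_pos hφ.self_of_nhds.2 hslope)
    refine tendsto_congr' ?_
    have hpos : ∀ᶠ h in 𝓝[>] 0, 0 < φ h := (hmap.le self_mem_nhdsWithin : _)
    filter_upwards [eventually_intervalIntegral_deriv_mul_comp (g := g) hφ0 hφ, hpos] with h hh hφh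
    rw [hh.2, Function.comp_apply, mul_assoc, mul_inv_cancel_left₀ hφh.ne']
  exact ⟨fun h => ⟨hint.mp h.1, htop.mp h.2⟩, fun h => ⟨hint.mpr h.1, htop.mpr h.2⟩⟩

end Substitution

section Inversion

variable {f g : ℝ → ℝ} {a ρ : ℝ}

/-- The local coordinate at `1 / a` that corresponds to the coordinate `u` of `a + ρ * u` under
`x ↦ 1 / x`, oriented so as to be increasing. -/
def invCoord (a ρ u : ℝ) : ℝ := u / (a * (a + ρ * u))

theorem eventually_add_mul_pos (ha : 0 < a) : ∀ᶠ u in 𝓝 0, 0 < a + ρ * u := by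
  have h : Continuous fun u => a + ρ * u := by fun_prop
  exact h.continuousAt.eventually_const_lt (by simpa using ha)

theorem inv_add_mul_eq {u : ℝ} (ha : a ≠ 0) (hu : a + ρ * u ≠ 0) :
    1 / (a + ρ * u) = 1 / a - ρ * invCoord a ρ u := by
  rw [invCoord]
  field_simp
  ring

theorem hasDerivAt_invCoord {u : ℝ} (ha : a ≠ 0) (hu : a + ρ * u ≠ 0) :
    HasDerivAt (invCoord a ρ) ((a + ρ * u) ^ 2)⁻¹ u := by
  have hlin : HasDerivAt (fun v => a * (a + ρ * v)) (a * ρ) u := by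
    simpa using (((hasDerivAt_id u).const_mul ρ).const_add a).const_mul a
  refine ((hasDerivAt_id u).div hlin (mul_ne_zero ha hu)).congr_deriv ?_
  rw [id]
  field_simp
  ring

@[fun_prop]
theorem measurable_invCoord : Measurable (invCoord a ρ) := by
  unfold invCoord
  fun_prop

theorem avgAtTop_iff_of_comp_invCoord {C : ℝ} (ha : 0 < a) (hf : Measurable f)
    (hg : Measurable g)
    (hC : ∀ᶠ u in 𝓝[>] 0, |f u - (a + ρ * u) * g (invCoord a ρ u)| ≤ C) :
    AvgAtTop f ↔ AvgAtTop g := by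
  have hφ : ∀ᶠ u in 𝓝 0, HasDerivAt (invCoord a ρ) ((a + ρ * u) ^ 2)⁻¹ u ∧
      0 < ((a + ρ * u) ^ 2)⁻¹ := by
    filter_upwards [eventually_add_mul_pos ha] with u hu
    exact ⟨hasDerivAt_invCoord ha.ne' hu.ne', by positivity⟩
  have hcube : (fun u => (a + ρ * u) * g (invCoord a ρ u)) =
      (fun u => (a + ρ * u) ^ 3) * fun u => ((a + ρ * u) ^ 2)⁻¹ * g (invCoord a ρ u) := by
    funext u
    simp only [Pi.mul_apply]
    field_simp
  rw [avgAtTop_iff_of_abs_sub_le hf (by fun_prop) hC,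
    hcube, avgAtTop_mul_iff (by fun_prop) (by fun_prop) (by rw [mul_zero, add_zero]; positivity),
    avgAtTop_deriv_mul_comp_iff (by simp [invCoord]) hφ]

end Inversion

/-! ### The functional equation -/

section Series

variable {α x a : ℝ}

/-- The `j`-th term of the Wilton series. -/
def wiltonTerm (α x : ℝ) (j : ℕ) : ℝ :=
  (-1 : ℝ) ^ j * betaProd α x j * Real.log (1 / |(T α)^[j] x|)

theorem measurable_digit (α : ℝ) : Measurable (digit α) :=
  Int.measurable_floor.comp (by fun_prop)

theorem measurable_T (α : ℝ) : Measurable (T α) := by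
  have hT : T α = fun x => if x = 0 then 0 else 1 / |x| - (digit α x : ℝ) := by
    funext x
    split_ifs with hx
    · rw [hx, T_zero]
    · exact T_of_ne_zero hx
  have hdigit : Measurable fun x => (digit α x : ℝ) := measurable_from_top.comp (measurable_digit α)
  rw [hT]
  exact .ite (measurableSet_singleton 0) measurable_const (by fun_prop)

@[fun_prop]
theorem measurable_iterate_T (α : ℝ) (j : ℕ) : Measurable (T α)^[j] :=
  (measurable_T α).iterate j

@[fun_prop]
theorem measurable_betaProd (α : ℝ) (j : ℕ) : Measurable fun x => betaProd α x j := by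
  unfold betaProd
  fun_prop

theorem measurable_wiltonTerm (α : ℝ) (j : ℕ) : Measurable fun x => wiltonTerm α x j := by
  unfold wiltonTerm
  fun_prop

theorem wiltonSeries_eq_tsum (α x : ℝ) :
    wiltonSeries α x = ∑'[SummationFilter.conditional ℕ] j : ℕ, wiltonTerm α x j := rfl

theorem measurable_wiltonSeries (α : ℝ) : Measurable (wiltonSeries α) :=
  .tsum fun j => measurable_wiltonTerm α j

@[fun_prop]
theorem measurable_wilton (α : ℝ) : Measurable (wilton α) := by
  have hfloor : Measurable fun x : ℝ => (⌊x + 1 - α⌋ : ℝ) :=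
    measurable_from_top.comp (Int.measurable_floor.comp (by fun_prop))
  exact (measurable_wiltonSeries α).comp (measurable_id.sub hfloor)

theorem wilton_of_mem_Ico (hx : x ∈ Ico (α - 1) α) : wilton α x = wiltonSeries α x := by
  have hfloor : ⌊x + 1 - α⌋ = 0 :=
    Int.floor_eq_zero_iff.mpr ⟨by linarith [hx.1], by linarith [hx.2]⟩
  rw [wilton, hfloor, Int.cast_zero, sub_zero]

theorem wilton_add_int (α x : ℝ) (n : ℤ) : wilton α (x + n) = wilton α x := by
  have hshift : x + n + 1 - α = x + 1 - α + n := by ring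
  rw [wilton, hshift, Int.floor_add_intCast, Int.cast_add, add_sub_add_right_eq_sub, wilton]

theorem wilton_one_div_abs (hx : x ≠ 0) : wilton α (1 / |x|) = wiltonSeries α (T α x) := by
  rw [← wilton_of_mem_Ico (T_mem_Ico hx), ← wilton_add_int α (T α x) (digit α x),
    T_of_ne_zero hx, sub_add_cancel]

theorem wiltonTerm_zero (α x : ℝ) : wiltonTerm α x 0 = -Real.log |x| := by
  simp [wiltonTerm, betaProd]

theorem betaProd_succ (α x : ℝ) (j : ℕ) : betaProd α x (j + 1) = |x| * betaProd α (T α x) j := by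
  rw [betaProd, Finset.prod_range_succ', mul_comm]
  rfl

theorem wiltonTerm_succ (α x : ℝ) (j : ℕ) :
    wiltonTerm α x (j + 1) = -|x| * wiltonTerm α (T α x) j := by
  rw [wiltonTerm, wiltonTerm, betaProd_succ, Function.iterate_succ_apply, pow_succ]
  ring

theorem hasSum_conditional_nat_iff {f : ℕ → ℝ} :
    HasSum f a (SummationFilter.conditional ℕ) ↔
      Tendsto (fun n => ∑ i ∈ Finset.range n, f i) atTop (𝓝 a) := by
  rw [HasSum, SummationFilter.conditional_filter_eq_map_range, tendsto_map'_iff]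
  rfl

theorem hasSum_wiltonTerm_iff (hx : x ≠ 0) :
    HasSum (wiltonTerm α x) (-|x| * a - Real.log |x|) (SummationFilter.conditional ℕ) ↔
      HasSum (wiltonTerm α (T α x)) a (SummationFilter.conditional ℕ) := by
  have hsum : ∀ n, ∑ i ∈ Finset.range (n + 1), wiltonTerm α x i =
      -|x| * ∑ i ∈ Finset.range n, wiltonTerm α (T α x) i - Real.log |x| := by
    intro n
    rw [Finset.sum_range_succ', wiltonTerm_zero, Finset.mul_sum, sub_eq_add_neg]
    simp_rw [wiltonTerm_succ]
  have hx' : -|x| ≠ 0 := neg_ne_zero.mpr (abs_ne_zero.mpr hx)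
  rw [hasSum_conditional_nat_iff, hasSum_conditional_nat_iff, ← tendsto_add_atTop_iff_nat 1]
  simp_rw [hsum, sub_eq_add_neg]
  rw [tendsto_add_const_iff]
  exact tendsto_const_smul_iff₀ hx'

theorem summable_wiltonTerm_T_iff (hx : x ≠ 0) :
    Summable (wiltonTerm α (T α x)) (SummationFilter.conditional ℕ) ↔
      Summable (wiltonTerm α x) (SummationFilter.conditional ℕ) := by
  refine ⟨fun ⟨a, ha⟩ => ⟨_, (hasSum_wiltonTerm_iff hx).mpr ha⟩, fun ⟨a, ha⟩ =>
    ⟨(-|x|)⁻¹ * (a + Real.log |x|), (hasSum_wiltonTerm_iff hx).mp ?_⟩⟩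
  have hx' : -|x| ≠ 0 := neg_ne_zero.mpr (abs_ne_zero.mpr hx)
  rwa [mul_inv_cancel_left₀ hx', add_sub_cancel_right]

theorem wilton_add_abs_mul_wilton (hx : x ∈ Ico (α - 1) α) (h0 : x ≠ 0)
    (h : Summable (wiltonTerm α x) (SummationFilter.conditional ℕ)) :
    wilton α x + |x| * wilton α (1 / |x|) = -Real.log |x| := by
  have hT := ((summable_wiltonTerm_T_iff h0).mpr h).hasSum
  rw [wilton_of_mem_Ico hx, wilton_one_div_abs h0, wiltonSeries_eq_tsum, wiltonSeries_eq_tsum,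
    ((hasSum_wiltonTerm_iff h0).mpr hT).tsum_eq]
  ring

-- Where the series diverges, both sides are junk and the left-hand side vanishes.
theorem abs_wilton_add_abs_mul_wilton_le (hx : x ∈ Ico (α - 1) α) (h0 : x ≠ 0) :
    |wilton α x + |x| * wilton α (1 / |x|)| ≤ |Real.log (|x|)| := by
  by_cases h : Summable (wiltonTerm α x) (SummationFilter.conditional ℕ)
  · rw [wilton_add_abs_mul_wilton hx h0 h, abs_neg]
  · rw [wilton_of_mem_Ico hx, wilton_one_div_abs h0, wiltonSeries_eq_tsum, wiltonSeries_eq_tsum,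
      tsum_eq_zero_of_not_summable h,
      tsum_eq_zero_of_not_summable (mt (summable_wiltonTerm_T_iff h0).mp h), mul_zero, add_zero,
      abs_zero]
    exact abs_nonneg _

end Series

section Sides

variable {α ξ σ s t : ℝ}

/-- The averages of `s * wilton α` on the side of `ξ` in the direction `σ` tend to `+∞`. -/
def SideTop (α ξ σ s : ℝ) : Prop := AvgAtTop fun u => s * wilton α (ξ + σ * u)

/-- On the side in the direction `σ`, the points near `ξ` lie in the domain `[α - 1, α)`. -/
def SideIn (α ξ σ : ℝ) : Prop := ∀ᶠ u in 𝓝[>] (0 : ℝ), ξ + σ * u ∈ Ico (α - 1) α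

theorem SideTop.unique (hs : |s| = 1) (ht : |t| = 1) (h : SideTop α ξ σ s)
    (h' : SideTop α ξ σ t) : s = t := by
  rcases abs_eq_abs.mp (hs.trans ht.symm) with rfl | rfl
  · rfl
  · exact absurd (h.congr' (.of_forall fun u => neg_mul _ _)) (AvgAtTop.not_neg h')

theorem sideTop_add_int (n : ℤ) : SideTop α (ξ + n) σ s ↔ SideTop α ξ σ s := by
  simp only [SideTop, add_right_comm ξ (n : ℝ), wilton_add_int]

theorem sideIn_of_mem_Ioo (hξ : ξ ∈ Ioo (α - 1) α) : SideIn α ξ σ := by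
  have hc : Continuous fun u => ξ + σ * u := by fun_prop
  refine nhdsWithin_le_nhds (hc.continuousAt.eventually_mem ?_)
  rw [mul_zero, add_zero]
  exact Ico_mem_nhds hξ.1 hξ.2

theorem sideIn_sub_one_one (α : ℝ) : SideIn α (α - 1) 1 := by
  filter_upwards [Ioo_mem_nhdsGT one_pos] with u hu
  constructor <;> linarith [hu.1, hu.2]

theorem sideIn_self_neg_one (α : ℝ) : SideIn α α (-1) := by
  filter_upwards [Ioo_mem_nhdsGT one_pos] with u hu
  constructor <;> linarith [hu.1, hu.2]

theorem abs_eps (hξ : ξ ≠ 0) : |(eps ξ : ℝ)| = 1 := by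
  rcases lt_or_gt_of_ne hξ with h | h
  · simp [eps_of_neg h]
  · simp [eps_of_pos h]

theorem add_mul_eq_eps_mul (hξ : ξ ≠ 0) (σ u : ℝ) :
    ξ + σ * u = eps ξ * (|ξ| + σ * eps ξ * u) := by
  have hsq : (eps ξ : ℝ) * eps ξ = 1 := by exact_mod_cast eps_mul_self hξ
  linear_combination -eps_mul_abs ξ - σ * u * hsq

/-- The functional equation moves a side of `ξ` to a side of `T α ξ`: the direction is reversed by
`x ↦ 1 / |x|` when `ξ` lies in that direction from `0`, and the sign changes. -/
theorem sideTop_T_iff (hξ : ξ ≠ 0) (hin : SideIn α ξ σ) :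
    SideTop α (T α ξ) (-(σ * eps ξ)) (-s) ↔ SideTop α ξ σ s := by
  obtain ⟨ρ, hρ⟩ : ∃ ρ : ℝ, σ * eps ξ = ρ := ⟨_, rfl⟩
  have ha : 0 < |ξ| := abs_pos.mpr hξ
  have hlog : ContinuousAt (fun u => |Real.log (|ξ + σ * u|)|) 0 :=
    (ContinuousAt.log (by fun_prop) (by simpa using hξ)).abs
  obtain ⟨C, hC⟩ := (hlog.mono_left nhdsWithin_le_nhds).isBoundedUnder_le
  rw [hρ]
  refine (avgAtTop_iff_of_comp_invCoord (a := |ξ|) (ρ := ρ) (C := |s| * C) ha (by fun_prop)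
    (by fun_prop) ?_).symm
  filter_upwards [hin, nhdsWithin_le_nhds (eventually_add_mul_pos ha), eventually_map.mp hC]
    with u hu hpos hCu
  have habs : |ξ + σ * u| = |ξ| + ρ * u := by
    rw [add_mul_eq_eps_mul hξ, hρ, abs_mul, abs_eps hξ, one_mul, abs_of_pos hpos]
  have hinv : wilton α (T α ξ + -ρ * invCoord |ξ| ρ u) = wilton α (1 / |ξ + σ * u|) := by
    rw [habs, inv_add_mul_eq ha.ne' hpos.ne', ← wilton_add_int _ _ (digit α ξ), T_of_ne_zero hξ]
    ring_nf
  have hne : ξ + σ * u ≠ 0 := abs_pos.mp (habs ▸ hpos)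
  rw [hinv, ← habs]
  calc |s * wilton α (ξ + σ * u) - |ξ + σ * u| * (-s * wilton α (1 / |ξ + σ * u|))|
      = |s| * |wilton α (ξ + σ * u) + |ξ + σ * u| * wilton α (1 / |ξ + σ * u|)| := by
        rw [← abs_mul]
        ring_nf
    _ ≤ |s| * C := by
        gcongr
        exact (abs_wilton_add_abs_mul_wilton_le hu hne).trans hCu

end Sides

/-! ### Integrability of the Wilton function -/

section Branches

variable {α σ x : ℝ} {k : ℕ}

/-- The part of the domain on the side `σ` of `0` on which `T α` has digit `k + 1`. -/
def branch (α σ : ℝ) (k : ℕ) : Set ℝ := {x | x ∈ Ico (α - 1) α ∧ 0 < σ * x ∧ digit α x = k + 1}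

theorem measurableSet_branch (α σ : ℝ) (k : ℕ) : MeasurableSet (branch α σ k) := by
  refine measurableSet_Ico.inter (.inter ?_ (measurable_digit α (measurableSet_singleton _)))
  exact measurableSet_lt measurable_const (measurable_id.const_mul σ)

theorem ne_zero_of_mem_branch (hx : x ∈ branch α σ k) : x ≠ 0 := right_ne_zero_of_mul hx.2.1.ne'

theorem one_lt_one_div_abs (h0 : 0 < α) (h1 : α ≤ 1) (hx : x ∈ Ico (α - 1) α) (hx0 : x ≠ 0) :
    1 < 1 / |x| :=
  (one_lt_div (abs_pos.mpr hx0)).mpr (abs_lt_one_of_mem_Ico h0 h1 hx)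

theorem mul_abs_le_two_of_mem_branch (h0 : 0 < α) (h1 : α ≤ 1) (hx : x ∈ branch α σ k) :
    (k + 1) * |x| ≤ 2 := by
  have hx0 := ne_zero_of_mem_branch hx
  have hdigit : (digit α x : ℝ) ≤ 1 / |x| + 1 - α := Int.floor_le _
  rw [hx.2.2] at hdigit
  push_cast at hdigit
  rw [← le_div_iff₀ (abs_pos.mpr hx0), ← mul_one_div]
  linarith [one_lt_one_div_abs h0 h1 hx.1 hx0]

theorem Ico_subset_union_branch (h0 : 0 < α) (h1 : α ≤ 1) :
    Ico (α - 1) α ⊆ {0} ∪ ((⋃ k, branch α 1 k) ∪ ⋃ k, branch α (-1) k) := by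
  intro x hx
  rcases eq_or_ne x 0 with rfl | hx0
  · exact Or.inl rfl
  have hdigit : 1 ≤ digit α x := by
    rw [digit, Int.le_floor, Int.cast_one]
    linarith [one_lt_one_div_abs h0 h1 hx hx0]
  have hk : digit α x = (digit α x - 1).toNat + 1 := by omega
  rcases lt_or_gt_of_ne hx0 with h | h
  · exact Or.inr (Or.inr (mem_iUnion.mpr ⟨_, hx, by linarith, hk⟩))
  · exact Or.inr (Or.inl (mem_iUnion.mpr ⟨_, hx, by linarith, hk⟩))

theorem T_eq_of_mem_branch (hσ : |σ| = 1) (hx : x ∈ branch α σ k) :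
    T α x = (σ * x)⁻¹ - (k + 1) := by
  have habs : |x| = σ * x := by rw [← abs_of_pos hx.2.1, abs_mul, hσ, one_mul]
  rw [T_of_ne_zero (ne_zero_of_mem_branch hx), hx.2.2, habs, one_div]
  push_cast
  rfl

theorem hasDerivAt_inv_mul (hσ : σ ≠ 0) (hx : x ≠ 0) (c : ℝ) :
    HasDerivAt (fun x => (σ * x)⁻¹ - c) (-σ / (σ * x) ^ 2) x := by
  simpa only [mul_one] using
    (((hasDerivAt_id' x).const_mul σ).fun_inv (mul_ne_zero hσ hx)).sub_const c

theorem lintegral_branch_le (h0 : 0 < α) (h1 : α ≤ 1) (hσ : |σ| = 1) (k : ℕ) (f : ℝ → ENNReal) :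
    ∫⁻ x in branch α σ k, f (T α x) ≤
      ENNReal.ofReal (4 / (k + 1 : ℝ) ^ 2) * ∫⁻ x in Ico (α - 1) α, f x := by
  have hσ0 : σ ≠ 0 := abs_pos.mp (hσ ▸ one_pos)
  have hinj : InjOn (fun x => (σ * x)⁻¹ - (k + 1 : ℝ)) (branch α σ k) := fun x _ y _ h =>
    mul_left_cancel₀ hσ0 (inv_injective (sub_left_injective h))
  have himage : (fun x => (σ * x)⁻¹ - (k + 1 : ℝ)) '' branch α σ k ⊆ Ico (α - 1) α := by
    rintro _ ⟨x, hx, rfl⟩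
    beta_reduce
    rw [← T_eq_of_mem_branch hσ hx]
    exact T_mem_Ico (ne_zero_of_mem_branch hx)
  have hone : ∀ x ∈ branch α σ k, 1 ≤ 4 / (k + 1 : ℝ) ^ 2 * |-σ / (σ * x) ^ 2| := by
    intro x hx
    have hpos := abs_pos.mpr (ne_zero_of_mem_branch hx)
    rw [abs_div, abs_neg, abs_pow, abs_mul, hσ, one_mul, div_mul_div_comm, mul_one, ← mul_pow,
      one_le_div (by positivity)]
    calc ((k + 1) * |x|) ^ 2 ≤ 2 ^ 2 := by gcongr; exact mul_abs_le_two_of_mem_branch h0 h1 hx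
      _ = 4 := by norm_num
  calc ∫⁻ x in branch α σ k, f (T α x)
      ≤ ∫⁻ x in branch α σ k, ENNReal.ofReal (4 / (k + 1 : ℝ) ^ 2) *
          (ENNReal.ofReal |-σ / (σ * x) ^ 2| * f ((σ * x)⁻¹ - (k + 1))) := by
        refine setLIntegral_mono' (measurableSet_branch α σ k) fun x hx => ?_
        rw [T_eq_of_mem_branch hσ hx, ← mul_assoc, ← ENNReal.ofReal_mul (by positivity)]
        exact le_mul_of_one_le_left zero_le (ENNReal.one_le_ofReal.mpr (hone x hx))
    _ = ENNReal.ofReal (4 / (k + 1 : ℝ) ^ 2) *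
          ∫⁻ x in (fun x => (σ * x)⁻¹ - (k + 1 : ℝ)) '' branch α σ k, f x := by
        rw [lintegral_const_mul' _ _ ENNReal.ofReal_ne_top,
          lintegral_image_eq_lintegral_abs_deriv_mul (measurableSet_branch α σ k)
            (fun x hx => (hasDerivAt_inv_mul hσ0 (ne_zero_of_mem_branch hx) _).hasDerivWithinAt)
            hinj]
    _ ≤ ENNReal.ofReal (4 / (k + 1 : ℝ) ^ 2) * ∫⁻ x in Ico (α - 1) α, f x := by gcongr

theorem exists_lintegral_comp_T_le (h0 : 0 < α) (h1 : α ≤ 1) :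
    ∃ C : ℝ, 1 ≤ C ∧ ∀ f : ℝ → ENNReal, ∫⁻ x in Ico (α - 1) α, f (T α x) ≤
      ENNReal.ofReal C * ∫⁻ x in Ico (α - 1) α, f x := by
  have hsum : Summable fun k : ℕ => 4 / (k + 1 : ℝ) ^ 2 := by
    have := (summable_nat_add_iff 1).mpr (Real.summable_one_div_nat_pow.mpr one_lt_two)
    exact (this.mul_left 4).congr fun k => by rw [mul_one_div, Nat.cast_add_one]
  set D := ∑' k : ℕ, 4 / (k + 1 : ℝ) ^ 2
  have hD : 0 ≤ D := tsum_nonneg fun k => by positivity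
  have hside : ∀ (σ : ℝ) (f : ℝ → ENNReal), |σ| = 1 → ∫⁻ x in ⋃ k, branch α σ k, f (T α x) ≤
      ENNReal.ofReal D * ∫⁻ x in Ico (α - 1) α, f x := by
    intro σ f hσ
    rw [ENNReal.ofReal_tsum_of_nonneg (fun k => by positivity) hsum, ← ENNReal.tsum_mul_right]
    exact (lintegral_iUnion_le _ _).trans
      (ENNReal.tsum_le_tsum fun k => lintegral_branch_le h0 h1 hσ k f)
  refine ⟨1 + (D + D), by linarith, fun f => ?_⟩
  calc ∫⁻ x in Ico (α - 1) α, f (T α x)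
      ≤ ∫⁻ x in {0} ∪ ((⋃ k, branch α 1 k) ∪ ⋃ k, branch α (-1) k), f (T α x) :=
        lintegral_mono_set (Ico_subset_union_branch h0 h1)
    _ ≤ 0 + (ENNReal.ofReal D * (∫⁻ x in Ico (α - 1) α, f x) +
          ENNReal.ofReal D * ∫⁻ x in Ico (α - 1) α, f x) := by
        refine (lintegral_union_le _ _ _).trans (add_le_add (by simp) ?_)
        exact (lintegral_union_le _ _ _).trans
          (add_le_add (hside 1 f (by simp)) (hside (-1) f (by simp)))
    _ ≤ ENNReal.ofReal (1 + (D + D)) * ∫⁻ x in Ico (α - 1) α, f x := by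
        rw [zero_add, ← add_mul, ← ENNReal.ofReal_add hD hD]
        gcongr ENNReal.ofReal ?_ * _
        linarith

end Branches

section Decay

variable {α r x : ℝ}

theorem lintegral_comp_iterate_le {X : Type*} [MeasurableSpace X] {μ : Measure X} {S : X → X}
    {C : ENNReal} (hS : ∀ f : X → ENNReal, ∫⁻ x, f (S x) ∂μ ≤ C * ∫⁻ x, f x ∂μ)
    (f : X → ENNReal) (j : ℕ) : ∫⁻ x, f (S^[j] x) ∂μ ≤ C ^ j * ∫⁻ x, f x ∂μ := by
  induction j with
  | zero => simp
  | succ j ih =>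
    calc ∫⁻ x, f (S^[j] (S x)) ∂μ ≤ C * ∫⁻ x, f (S^[j] x) ∂μ := hS fun x => f (S^[j] x)
      _ ≤ C * (C ^ j * ∫⁻ x, f x ∂μ) := by gcongr
      _ = C ^ (j + 1) * ∫⁻ x, f x ∂μ := by rw [pow_succ', mul_assoc]

theorem mul_T_one_le_half (hx : x ∈ Ico (0 : ℝ) 1) : x * T 1 x ≤ 1 / 2 := by
  rcases eq_or_lt_of_le hx.1 with rfl | hpos
  · simp
  have hT := T_mem_Ico (α := 1) hpos.ne'
  have heq := T_of_ne_zero (α := 1) hpos.ne'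
  have hdigit : (1 : ℝ) ≤ digit 1 x := by
    have : (1 : ℤ) ≤ digit 1 x := by
      rw [digit, Int.le_floor, add_sub_cancel_right, abs_of_pos hpos, Int.cast_one]
      exact (one_le_div hpos).mpr hx.2.le
    exact_mod_cast this
  rw [abs_of_pos hpos] at heq
  have hmul : x * T 1 x = 1 - x * digit 1 x := by
    rw [heq, mul_sub, mul_one_div_cancel hpos.ne']
  nlinarith [hT.2]

theorem exists_abs_mul_abs_T_le (h0 : 0 < α) (h1 : α ≤ 1) :
    ∃ r ∈ Ioo (0 : ℝ) 1, ∀ x ∈ Ico (α - 1) α, |x| * |T α x| ≤ r ^ 2 := by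
  rcases eq_or_lt_of_le h1 with rfl | hlt
  · refine ⟨3 / 4, by norm_num, fun x hx => ?_⟩
    rw [sub_self] at hx
    have hT : 0 ≤ T 1 x := by simpa using (mapsTo_T 1 (by simpa using hx)).1
    rw [abs_of_nonneg hx.1, abs_of_nonneg hT]
    linarith [mul_T_one_le_half hx]
  · have hle : ∀ x ∈ Ico (α - 1) α, |x| ≤ max α (1 - α) := fun x hx => abs_le.mpr
      ⟨by linarith [hx.1, le_max_right α (1 - α)], hx.2.le.trans (le_max_left _ _)⟩
    refine ⟨max α (1 - α), ⟨lt_max_of_lt_left h0, max_lt hlt (by linarith)⟩, fun x hx => ?_⟩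
    rw [sq]
    exact mul_le_mul (hle x hx) (hle _ (mapsTo_T α hx)) (abs_nonneg _)
      (h0.le.trans (le_max_left _ _))

theorem betaProd_nonneg (α x : ℝ) (j : ℕ) : 0 ≤ betaProd α x j :=
  Finset.prod_nonneg fun _ _ => abs_nonneg _

theorem betaProd_le (h0 : 0 < α) (h1 : α ≤ 1) (hr : r ∈ Ioo (0 : ℝ) 1)
    (h : ∀ x ∈ Ico (α - 1) α, |x| * |T α x| ≤ r ^ 2) (j : ℕ) :
    ∀ x ∈ Ico (α - 1) α, betaProd α x j ≤ r⁻¹ * r ^ j := by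
  have hr0 := hr.1
  induction j using Nat.twoStepInduction with
  | zero =>
    intro x _
    rw [betaProd, Finset.prod_range_zero, pow_zero, mul_one]
    exact (one_le_inv₀ hr0).mpr hr.2.le
  | one =>
    intro x hx
    rw [betaProd, Finset.prod_range_one, pow_one, inv_mul_cancel₀ hr0.ne']
    exact (abs_lt_one_of_mem_Ico h0 h1 hx).le
  | more j ih _ =>
    intro x hx
    rw [betaProd_succ, betaProd_succ, ← mul_assoc]
    calc |x| * |T α x| * betaProd α (T α (T α x)) j ≤ r ^ 2 * (r⁻¹ * r ^ j) :=
          mul_le_mul (h x hx) (ih _ (mapsTo_T α (mapsTo_T α hx))) (betaProd_nonneg _ _ _)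
            (by positivity)
      _ = r⁻¹ * r ^ (j + 2) := by ring

theorem lintegral_abs_rpow_ne_top (a b : ℝ) (hab : a ≤ b) {p : ℝ} (hp : -1 < p) :
    ∫⁻ x in Ico a b, ENNReal.ofReal (|x| ^ p) ≠ ⊤ := by
  have h : IntervalIntegrable (fun x : ℝ => |x| ^ p) volume a b := by
    refine intervalIntegrable_of_even (fun x => by rw [abs_neg]) fun x hx => ?_
    refine (intervalIntegral.intervalIntegrable_rpow' hp).congr fun y hy => ?_
    rw [uIoc_of_le hx.le] at hy
    rw [abs_of_pos hy.1]
  rw [intervalIntegrable_iff_integrableOn_Ico_of_le hab] at h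
  have hfin := h.hasFiniteIntegral
  rw [hasFiniteIntegral_iff_ofReal (.of_forall fun x => by positivity)] at hfin
  exact hfin.ne

theorem neg_log_le {a u : ℝ} (ha : 1 ≤ a) (hu : 0 ≤ u) :
    -Real.log u ≤ 2 * Real.log a + 2 * (a⁻¹ * u ^ (-(1 / 2) : ℝ)) := by
  have : 0 < a := by linarith
  rcases eq_or_lt_of_le hu with rfl | hpos
  · have := Real.log_nonneg ha
    rw [Real.log_zero, neg_zero]
    positivity
  · have hlog : Real.log (a⁻¹ * u ^ (-(1 / 2) : ℝ)) ≤ a⁻¹ * u ^ (-(1 / 2) : ℝ) :=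
      Real.log_le_self (by positivity)
    rw [Real.log_mul (by positivity) (by positivity), Real.log_inv, Real.log_rpow hpos] at hlog
    linarith

end Decay

section Convergence

variable {α C x : ℝ}

theorem lintegral_neg_log_iterate_le (hC1 : 1 ≤ C)
    (hC : ∀ f : ℝ → ENNReal, ∫⁻ x in Ico (α - 1) α, f (T α x) ≤
      ENNReal.ofReal C * ∫⁻ x in Ico (α - 1) α, f x) (j : ℕ) :
    ∫⁻ x in Ico (α - 1) α, ENNReal.ofReal (-Real.log (|(T α)^[j] x|)) ≤
      ENNReal.ofReal (2 * (j * Real.log C)) +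
        ENNReal.ofReal 2 * ∫⁻ x in Ico (α - 1) α, ENNReal.ofReal (|x| ^ (-(1 / 2) : ℝ)) := by
  have hC0 : 0 < C := one_pos.trans_le hC1
  have hlogC : 0 ≤ 2 * (j * Real.log C) := by have := Real.log_nonneg hC1; positivity
  set g : ℝ → ENNReal := fun x => ENNReal.ofReal (|x| ^ (-(1 / 2) : ℝ))
  have hpoint : ∀ y : ℝ, ENNReal.ofReal (-Real.log (|y|)) ≤
      ENNReal.ofReal (2 * (j * Real.log C)) + ENNReal.ofReal (2 * (C ^ j)⁻¹) * g y := by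
    intro y
    rw [← ENNReal.ofReal_mul (by positivity), ← ENNReal.ofReal_add hlogC (by positivity),
      ← Real.log_pow, mul_assoc]
    exact ENNReal.ofReal_le_ofReal (neg_log_le (one_le_pow₀ hC1) (abs_nonneg y))
  calc ∫⁻ x in Ico (α - 1) α, ENNReal.ofReal (-Real.log (|(T α)^[j] x|))
      ≤ ∫⁻ x in Ico (α - 1) α, (ENNReal.ofReal (2 * (j * Real.log C)) +
          ENNReal.ofReal (2 * (C ^ j)⁻¹) * g ((T α)^[j] x)) := lintegral_mono fun x => hpoint _
    _ = ENNReal.ofReal (2 * (j * Real.log C)) +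
          ENNReal.ofReal (2 * (C ^ j)⁻¹) * ∫⁻ x in Ico (α - 1) α, g ((T α)^[j] x) := by
        rw [lintegral_add_left measurable_const, lintegral_const_mul' _ _ ENNReal.ofReal_ne_top]
        simp
    _ ≤ ENNReal.ofReal (2 * (j * Real.log C)) +
          ENNReal.ofReal (2 * (C ^ j)⁻¹) * (ENNReal.ofReal C ^ j * ∫⁻ x in Ico (α - 1) α, g x) := by
        gcongr
        exact lintegral_comp_iterate_le hC g j
    _ = ENNReal.ofReal (2 * (j * Real.log C)) +
          ENNReal.ofReal 2 * ∫⁻ x in Ico (α - 1) α, g x := by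
        rw [← mul_assoc (ENNReal.ofReal _), ← ENNReal.ofReal_pow hC0.le,
          ← ENNReal.ofReal_mul (by positivity), inv_mul_cancel_right₀ (by positivity)]

theorem enorm_wiltonTerm (h0 : 0 < α) (h1 : α ≤ 1) (hx : x ∈ Ico (α - 1) α) (j : ℕ) :
    ‖wiltonTerm α x j‖ₑ =
      ENNReal.ofReal (betaProd α x j) * ENNReal.ofReal (-Real.log (|(T α)^[j] x|)) := by
  have hlog : 0 ≤ -Real.log (|(T α)^[j] x|) := neg_nonneg.mpr <|
    Real.log_nonpos (abs_nonneg _) (abs_lt_one_of_mem_Ico h0 h1 (iterate_T_mem_Ico hx j)).le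
  rw [← ENNReal.ofReal_mul (betaProd_nonneg α x j), Real.enorm_eq_ofReal_abs, wiltonTerm, one_div,
    Real.log_inv, mul_assoc, abs_mul, abs_neg_one_pow, one_mul,
    abs_of_nonneg (mul_nonneg (betaProd_nonneg α x j) hlog)]

theorem tsum_lintegral_wiltonTerm_ne_top (h0 : 0 < α) (h1 : α ≤ 1) :
    ∑' j, ∫⁻ x in Ico (α - 1) α, ‖wiltonTerm α x j‖ₑ ≠ ⊤ := by
  obtain ⟨C, hC1, hC⟩ := exists_lintegral_comp_T_le h0 h1
  obtain ⟨r, hr, hrT⟩ := exists_abs_mul_abs_T_le h0 h1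
  have hr0 := hr.1
  set K := ∫⁻ x in Ico (α - 1) α, ENNReal.ofReal (|x| ^ (-(1 / 2) : ℝ))
  have hK : K ≠ ⊤ := lintegral_abs_rpow_ne_top _ _ (by linarith) (by norm_num)
  have hterm : ∀ j, ∫⁻ x in Ico (α - 1) α, ‖wiltonTerm α x j‖ₑ ≤
      ENNReal.ofReal (r⁻¹ * r ^ j * (2 * (j * Real.log C))) +
        ENNReal.ofReal (r⁻¹ * r ^ j) * (ENNReal.ofReal 2 * K) := by
    intro j
    calc ∫⁻ x in Ico (α - 1) α, ‖wiltonTerm α x j‖ₑ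
        ≤ ∫⁻ x in Ico (α - 1) α, ENNReal.ofReal (r⁻¹ * r ^ j) *
            ENNReal.ofReal (-Real.log (|(T α)^[j] x|)) := by
          refine setLIntegral_mono' measurableSet_Ico fun x hx => ?_
          rw [enorm_wiltonTerm h0 h1 hx]
          gcongr
          exact betaProd_le h0 h1 hr hrT j x hx
      _ = ENNReal.ofReal (r⁻¹ * r ^ j) *
            ∫⁻ x in Ico (α - 1) α, ENNReal.ofReal (-Real.log (|(T α)^[j] x|)) :=
          lintegral_const_mul' _ _ ENNReal.ofReal_ne_top
      _ ≤ ENNReal.ofReal (r⁻¹ * r ^ j) *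
            (ENNReal.ofReal (2 * (j * Real.log C)) + ENNReal.ofReal 2 * K) := by
          gcongr
          exact lintegral_neg_log_iterate_le hC1 hC j
      _ = _ := by rw [mul_add, ← ENNReal.ofReal_mul (by positivity)]
  have hgeom : Summable fun j : ℕ => r⁻¹ * r ^ j :=
    (summable_geometric_of_lt_one hr0.le hr.2).mul_left _
  have hgeom' : Summable fun j : ℕ => r⁻¹ * r ^ j * (2 * (j * Real.log C)) := by
    have := (summable_pow_mul_geometric_of_norm_lt_one 1 (r := r)
      (by rw [Real.norm_of_nonneg hr0.le]; exact hr.2)).mul_left (r⁻¹ * 2 * Real.log C)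
    exact this.congr fun j => by ring
  refine ne_top_of_le_ne_top ?_ (ENNReal.tsum_le_tsum hterm)
  rw [ENNReal.tsum_add, ENNReal.tsum_mul_right]
  exact ENNReal.add_ne_top.mpr ⟨hgeom'.tsum_ofReal_ne_top, ENNReal.mul_ne_top
    hgeom.tsum_ofReal_ne_top (ENNReal.mul_ne_top ENNReal.ofReal_ne_top hK)⟩

theorem lintegral_tsum_wiltonTerm_ne_top (h0 : 0 < α) (h1 : α ≤ 1) :
    ∫⁻ x in Ico (α - 1) α, ∑' j, ‖wiltonTerm α x j‖ₑ ≠ ⊤ := by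
  rw [lintegral_tsum fun j => (measurable_wiltonTerm α j).enorm.aemeasurable]
  exact tsum_lintegral_wiltonTerm_ne_top h0 h1

theorem ae_summable_wiltonTerm (h0 : 0 < α) (h1 : α ≤ 1) :
    ∀ᵐ x ∂volume.restrict (Ico (α - 1) α), Summable (wiltonTerm α x) := by
  have hmeas : Measurable fun x => ∑' j, ‖wiltonTerm α x j‖ₑ :=
    .tsum fun j => (measurable_wiltonTerm α j).enorm
  filter_upwards [ae_lt_top hmeas (lintegral_tsum_wiltonTerm_ne_top h0 h1)] with x hx
  exact (tsum_enorm_ne_top_iff_summable_norm.mp hx.ne).of_norm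

theorem integrableOn_wiltonSeries (h0 : 0 < α) (h1 : α ≤ 1) :
    IntegrableOn (wiltonSeries α) (Ico (α - 1) α) := by
  refine ⟨(measurable_wiltonSeries α).aestronglyMeasurable,
    (lintegral_mono_ae ?_).trans_lt (lintegral_tsum_wiltonTerm_ne_top h0 h1).lt_top⟩
  filter_upwards [ae_summable_wiltonTerm h0 h1] with x hx
  rw [wiltonSeries_eq_tsum, tsum_eq_of_summable_unconditional hx]
  exact enorm_tsum_le_tsum_enorm

theorem integrableOn_wilton_one_div_abs (h0 : 0 < α) (h1 : α ≤ 1) :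
    IntegrableOn (fun x => wilton α (1 / |x|)) (Ico (α - 1) α) := by
  obtain ⟨C, -, hC⟩ := exists_lintegral_comp_T_le h0 h1
  have hcomp : IntegrableOn (fun x => wiltonSeries α (T α x)) (Ico (α - 1) α) :=
    ⟨((measurable_wiltonSeries α).comp (measurable_T α)).aestronglyMeasurable,
      (hC fun y => ‖wiltonSeries α y‖ₑ).trans_lt
        (ENNReal.mul_lt_top ENNReal.ofReal_lt_top (integrableOn_wiltonSeries h0 h1).2)⟩
  refine hcomp.congr (ae_restrict_of_ae ?_)
  filter_upwards [Measure.ae_ne volume 0] with x hx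
  rw [wilton_one_div_abs hx]

theorem ae_wilton_add_abs_mul_wilton (h0 : 0 < α) (h1 : α ≤ 1) :
    ∀ᵐ x ∂volume.restrict (Ico (α - 1) α),
      wilton α x + |x| * wilton α (1 / |x|) = -Real.log |x| := by
  filter_upwards [ae_summable_wiltonTerm h0 h1, ae_restrict_mem measurableSet_Ico,
    ae_restrict_of_ae (Measure.ae_ne volume 0)] with x hx hmem hne
  exact wilton_add_abs_mul_wilton hmem hne
    ⟨_, hx.hasSum.mono_left SummationFilter.LeAtTop.le_atTop⟩

end Convergence

/-! ### One-sided behaviour at rational points -/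

section SideTop

variable {α ξ σ : ℝ} {k : ℕ}

theorem avgAtTop_neg_log : AvgAtTop fun u => -Real.log u := by
  refine ⟨integrableAtFilter_nhdsGT_iff.mpr
    (.of_forall fun h => intervalIntegral.intervalIntegrable_log'.neg), ?_⟩
  have hlim : Tendsto (fun h => -Real.log h + 1) (𝓝[>] 0) atTop :=
    tendsto_atTop_add_const_right _ _ (tendsto_neg_atBot_atTop.comp Real.tendsto_log_nhdsGT_zero)
  refine hlim.congr' ?_
  filter_upwards [self_mem_nhdsWithin] with h hpos
  rw [intervalIntegral.integral_neg, integral_log_from_zero, eq_inv_mul_iff_mul_eq₀ (ne_of_gt hpos)]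
  ring

theorem measurePreserving_add_mul (hσ : |σ| = 1) (ξ : ℝ) :
    MeasurePreserving fun u : ℝ => ξ + σ * u := by
  rcases (abs_eq zero_le_one).mp hσ with rfl | rfl
  · simpa only [one_mul] using measurePreserving_add_left volume ξ
  · simpa only [neg_one_mul, ← sub_eq_add_neg] using Measure.measurePreserving_sub_left volume ξ

theorem integrableAtFilter_comp_add_mul {w : ℝ → ℝ} {U : Set ℝ} (hσ : |σ| = 1)
    (hw : IntegrableOn w U) (hU : ∀ᶠ u in 𝓝[>] 0, ξ + σ * u ∈ U) :
    IntegrableAtFilter (fun u => w (ξ + σ * u)) (𝓝[>] 0) := by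
  have hemb : MeasurableEmbedding fun u : ℝ => ξ + σ * u :=
    (measurableEmbedding_addLeft ξ).comp
      (measurableEmbedding_mulLeft₀ (abs_pos.mp (hσ ▸ one_pos)))
  exact ⟨_, hU, ((measurePreserving_add_mul hσ ξ).integrableOn_comp_preimage hemb).mpr hw⟩

theorem sideTop_zero (h0 : 0 < α) (h1 : α ≤ 1) (hσ : |σ| = 1) (hin : SideIn α 0 σ) :
    SideTop α 0 σ 1 := by
  have hq : IntegrableAtFilter (fun u => wilton α (1 / |0 + σ * u|)) (𝓝[>] 0) :=
    integrableAtFilter_comp_add_mul hσ (integrableOn_wilton_one_div_abs h0 h1) hin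
  have hae := (measurePreserving_add_mul hσ 0).quasiMeasurePreserving.ae
    ((ae_restrict_iff' measurableSet_Ico).mp (ae_wilton_add_abs_mul_wilton h0 h1))
  have hO : (fun u : ℝ => -u) =O[𝓝[>] 0] id := (Asymptotics.isBigO_refl id _).neg_left
  refine (avgAtTop_neg_log.add_mul measurable_neg hO hq).congr ?_
  filter_upwards [hin.filter_mono inf_le_left, hae.filter_mono inf_le_right,
    Eventually.filter_mono inf_le_left (self_mem_nhdsWithin (s := Ioi 0))] with u hu hfun hpos
  have habs : |0 + σ * u| = u := by rw [zero_add, abs_mul, hσ, one_mul, abs_of_pos hpos]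
  have := hfun hu
  rw [habs] at this
  simp only [Pi.add_apply, Pi.mul_apply, habs]
  linarith

theorem FirstZero.sideTop (h0 : 0 < α) (h1 : α ≤ 1) (hk : FirstZero α ξ k) (hσ : |σ| = 1)
    (hin : SideIn α ξ σ) (horbit : ∀ i < k, (T α)^[i + 1] ξ ∈ Ioo (α - 1) α) :
    SideTop α ξ σ ((-1) ^ k) := by
  induction k generalizing ξ σ with
  | zero =>
    obtain rfl : ξ = 0 := hk.1
    exact sideTop_zero h0 h1 hσ hin
  | succ k ih =>
    have hξ : ξ ≠ 0 := hk.2 0 k.succ_pos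
    rw [← sideTop_T_iff hξ hin, pow_succ, mul_neg_one, neg_neg]
    refine ih ?_ ?_ (sideIn_of_mem_Ioo (horbit 0 k.succ_pos)) fun i hi => horbit (i + 1) (by lia)
    · exact (Nat.add_comm k 1 ▸ hk).iterate
    · rw [abs_neg, abs_mul, hσ, abs_eps hξ, one_mul]

end SideTop

/-! ### Types of singularities -/

section Types

variable {α ξ s t : ℝ} {k : ℕ} {w : ℝ → ℝ}

theorem forall_abs_eq_one {p : ℝ → Prop} : (∀ σ, |σ| = 1 → p σ) ↔ p 1 ∧ p (-1) := by
  simp only [abs_eq zero_le_one, or_imp, forall_and, forall_eq]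

theorem exists_abs_eq_one {p : ℝ → Prop} : (∃ s, |s| = 1 ∧ p s) ↔ p 1 ∨ p (-1) := by
  simp only [abs_eq zero_le_one, or_and_right, exists_or, exists_eq_left]

theorem tendsto_nhdsNE_zero_iff {X : Type*} {F : ℝ → X} {l : Filter X} :
    Tendsto F (𝓝[≠] 0) l ↔
      Tendsto F (𝓝[>] 0) l ∧ Tendsto (fun h => F (-h)) (𝓝[>] 0) l := by
  have hmap : map (fun h : ℝ => -h) (𝓝[>] 0) = 𝓝[<] 0 := by simp
  rw [← nhdsLT_sup_nhdsGT, tendsto_sup, and_comm, ← hmap, tendsto_map'_iff]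
  rfl

theorem exists_Ioo_integrableOn_iff :
    (∃ a b, ξ ∈ Ioo a b ∧ IntegrableOn w (Ioo a b)) ↔
      ∀ σ, |σ| = 1 → IntegrableAtFilter (fun u => w (ξ + σ * u)) (𝓝[>] 0) := by
  constructor
  · rintro ⟨a, b, hab, hw⟩ σ hσ
    refine integrableAtFilter_comp_add_mul hσ hw (nhdsWithin_le_nhds ?_)
    have hc : Continuous fun u => ξ + σ * u := by fun_prop
    exact hc.continuousAt.eventually_mem (by simpa using Ioo_mem_nhds hab.1 hab.2)
  · rw [forall_abs_eq_one, integrableAtFilter_nhdsGT_iff, integrableAtFilter_nhdsGT_iff]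
    rintro ⟨hr, hl⟩
    obtain ⟨h, ⟨hr, hl⟩, hpos : 0 < h⟩ := ((hr.and hl).and self_mem_nhdsWithin).exists
    simp only [one_mul, neg_one_mul, ← sub_eq_add_neg] at hr hl
    have hr' : IntervalIntegrable w volume ξ (ξ + h) := by
      simpa [add_comm] using hr.comp_sub_right ξ
    have hl' : IntervalIntegrable w volume ξ (ξ - h) := by simpa using hl.comp_sub_left ξ
    refine ⟨ξ - h, ξ + h, ⟨by linarith, by linarith⟩, ?_⟩
    exact ((intervalIntegrable_iff_integrableOn_Ioc_of_le (by linarith)).mp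
      (hl'.symm.trans hr')).mono_set Ioo_subset_Ioc_self

/-- The average of `w` over the interval of length `h` on the side of `ξ` in the direction `σ`. -/
def sideAvg (w : ℝ → ℝ) (ξ σ h : ℝ) : ℝ := h⁻¹ * ∫ u in (0 : ℝ)..h, w (ξ + σ * u)

theorem sideTop_iff (hs : s ≠ 0) (σ : ℝ) : SideTop α ξ σ s ↔
    IntegrableAtFilter (fun u => wilton α (ξ + σ * u)) (𝓝[>] 0) ∧
      Tendsto (fun h => s * sideAvg (wilton α) ξ σ h) (𝓝[>] 0) atTop := by
  have hint : ∀ {f : ℝ → ℝ}, IntegrableAtFilter (fun u => s * f u) (𝓝[>] 0) ↔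
      IntegrableAtFilter f (𝓝[>] 0) := fun {f} =>
    ⟨fun h => by simpa [Pi.smul_def, hs] using h.smul s⁻¹, fun h => h.smul s⟩
  have havg : ∀ h, s * sideAvg (wilton α) ξ σ h =
      h⁻¹ * ∫ u in (0 : ℝ)..h, s * wilton α (ξ + σ * u) := fun h => by
    rw [intervalIntegral.integral_const_mul, mul_left_comm, sideAvg]
  simp only [havg]
  exact ⟨fun h => ⟨hint.mp h.1, h.2⟩, fun h => ⟨hint.mpr h.1, h.2⟩⟩

theorem one_div_mul_integral (w : ℝ → ℝ) (ξ h : ℝ) :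
    (1 / h) * ∫ t in ξ..(ξ + h), w t = sideAvg w ξ 1 h := by
  simp only [sideAvg, one_mul, one_div]
  rw [intervalIntegral.integral_comp_add_left, add_zero]

theorem sideAvg_one_neg (w : ℝ → ℝ) (ξ h : ℝ) : sideAvg w ξ 1 (-h) = sideAvg w ξ (-1) h := by
  have hint : ∫ u in (0 : ℝ)..h, w (ξ + -u) = ∫ u in -h..0, w (ξ + u) := by
    simpa using intervalIntegral.integral_comp_neg (a := 0) (b := h) fun u => w (ξ + u)
  simp only [sideAvg, one_mul, hint, inv_neg, neg_mul_comm]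
  rw [intervalIntegral.integral_symm 0 (-h)]

theorem isTypeB_iff : IsTypeB (wilton α) ξ ↔
    ∃ s, |s| = 1 ∧ ∀ σ, |σ| = 1 → SideTop α ξ σ s := by
  rw [IsTypeB, exists_Ioo_integrableOn_iff, tendsto_nhdsNE_zero_iff, tendsto_nhdsNE_zero_iff]
  simp only [one_div_mul_integral, sideAvg_one_neg, forall_abs_eq_one, exists_abs_eq_one,
    sideTop_iff one_ne_zero, sideTop_iff (neg_ne_zero.mpr one_ne_zero), one_mul, neg_one_mul,
    tendsto_neg_atTop_iff]
  tauto

theorem isTypeA_iff : IsTypeA (wilton α) ξ ↔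
    ∃ s, |s| = 1 ∧ ∀ σ, |σ| = 1 → SideTop α ξ σ (σ * s) := by
  have hright : (fun h => (1 / |h|) * ∫ t in ξ..(ξ + h), wilton α t) =ᶠ[𝓝[>] 0]
      sideAvg (wilton α) ξ 1 := by
    filter_upwards [self_mem_nhdsWithin] with h hpos
    rw [abs_of_pos hpos, one_div_mul_integral]
  have hleft : (fun h => (1 / |(-h)|) * ∫ t in ξ..(ξ + -h), wilton α t) =ᶠ[𝓝[>] 0]
      fun h => -sideAvg (wilton α) ξ (-1) h := by
    filter_upwards [self_mem_nhdsWithin] with h hpos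
    rw [← sideAvg_one_neg, ← one_div_mul_integral, abs_neg, abs_of_pos hpos,
      one_div_neg_eq_neg_one_div, neg_mul, neg_neg]
  rw [IsTypeA, exists_Ioo_integrableOn_iff, tendsto_nhdsNE_zero_iff, tendsto_nhdsNE_zero_iff,
    tendsto_congr' hright, tendsto_congr' hright, tendsto_congr' hleft, tendsto_congr' hleft]
  simp only [forall_abs_eq_one, exists_abs_eq_one, one_mul, neg_one_mul, neg_neg,
    sideTop_iff one_ne_zero, sideTop_iff (neg_ne_zero.mpr one_ne_zero),
    tendsto_neg_atTop_iff, tendsto_neg_atBot_iff]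
  tauto

theorem isTypeB_iff_of_sideTop (hs : |s| = 1) (ht : |t| = 1) (hr : SideTop α ξ 1 s)
    (hl : SideTop α ξ (-1) t) : IsTypeB (wilton α) ξ ↔ s = t := by
  rw [isTypeB_iff]
  constructor
  · rintro ⟨r, hr1, h⟩
    rw [hr.unique hs hr1 (h 1 abs_one), hl.unique ht hr1 (h (-1) (by simp))]
  · rintro rfl
    exact ⟨s, hs, forall_abs_eq_one.mpr ⟨hr, hl⟩⟩

theorem isTypeA_of_sideTop (hs : |s| = 1) (hr : SideTop α ξ 1 s) (hl : SideTop α ξ (-1) (-s)) :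
    IsTypeA (wilton α) ξ :=
  isTypeA_iff.mpr ⟨s, hs, forall_abs_eq_one.mpr ⟨by rwa [one_mul], by rwa [neg_one_mul]⟩⟩

theorem isTypeB_T_iff (hξ : ξ ∈ Ioo (α - 1) α) (h0 : ξ ≠ 0) :
    IsTypeB (wilton α) (T α ξ) ↔ IsTypeB (wilton α) ξ := by
  simp only [isTypeB_iff, exists_abs_eq_one, forall_abs_eq_one,
    ← sideTop_T_iff h0 (sideIn_of_mem_Ioo hξ)]
  rcases lt_or_gt_of_ne h0 with h | h
  · simp only [eps_of_neg h]
    norm_num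
    tauto
  · simp only [eps_of_pos h]
    norm_num
    tauto

theorem isTypeA_T_iff (hξ : ξ ∈ Ioo (α - 1) α) (h0 : ξ ≠ 0) :
    IsTypeA (wilton α) (T α ξ) ↔ IsTypeA (wilton α) ξ := by
  simp only [isTypeA_iff, exists_abs_eq_one, forall_abs_eq_one,
    ← sideTop_T_iff h0 (sideIn_of_mem_Ioo hξ)]
  rcases lt_or_gt_of_ne h0 with h | h
  · simp only [eps_of_neg h]
    norm_num
    tauto
  · simp only [eps_of_pos h]
    norm_num
    tauto

theorem iterate_T_iff {p : ℝ → Prop} (hp : ∀ x ∈ Ioo (α - 1) α, x ≠ 0 → (p (T α x) ↔ p x))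
    (horbit : ∀ i < k, (T α)^[i] ξ ∈ Ioo (α - 1) α ∧ (T α)^[i] ξ ≠ 0) :
    p ((T α)^[k] ξ) ↔ p ξ := by
  induction k with
  | zero => rfl
  | succ k ih =>
    obtain ⟨hmem, hne⟩ := horbit k k.lt_succ_self
    rw [Function.iterate_succ_apply', hp _ hmem hne, ih fun i hi => horbit i (by lia)]

end Types

section RationalPoints

variable {α ξ : ℝ} {a r : ℚ} {n m k : ℕ}

theorem isTypeB_of_forall_iterate_ne (hα : α ∈ Icc (0 : ℝ) 1) (hr : (r : ℝ) ∈ Ico (α - 1) α)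
    (hne : ∀ k, (T α)^[k] r ≠ α - 1) : IsTypeB (wilton α) r := by
  have hIoo (k : ℕ) : (T α)^[k] r ∈ Ioo (α - 1) α :=
    have h := iterate_T_mem_Ico hr k
    ⟨h.1.lt_of_ne (hne k).symm, h.2⟩
  have h0 : 0 < α := by
    refine hα.1.lt_of_ne fun h => ?_
    obtain ⟨k, hk⟩ := exists_iterate_T_eq_zero_or_neg_one hα r hr
    have := hIoo k
    rcases hk with hk | hk <;> rw [hk, ← h] at this <;> norm_num at this
  obtain ⟨k, hk⟩ := exists_firstZero (exists_iterate_T_eq_zero h0 hα.2 hr)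
  exact isTypeB_iff.mpr ⟨(-1) ^ k, by simp, fun σ hσ =>
    hk.sideTop h0 hα.2 hσ (sideIn_of_mem_Ioo (hIoo 0)) fun i _ => hIoo (i + 1)⟩

theorem iterate_T_mem_Ioo (h0 : 0 < (a : ℝ)) (h1 : (a : ℝ) < 1) (hr : |(r : ℝ)| < 1)
    (hden : r.den = a.den) (i : ℕ) : (T a)^[i + 1] r ∈ Ioo ((a : ℝ) - 1) a := by
  have hne := iterate_T_ne_sub_one h0 h1 hr hden i
  rw [Function.iterate_succ_apply'] at hne ⊢
  rcases eq_or_ne ((T a)^[i] r) 0 with h | h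
  · rw [h, T_zero]
    exact ⟨by linarith, h0⟩
  · have hmem := T_mem_Ico (α := a) h
    exact ⟨hmem.1.lt_of_ne hne.symm, hmem.2⟩

theorem exists_firstZero_sideTop_right (h0 : 0 < (a : ℝ)) (h1 : (a : ℝ) ≤ 1) :
    ∃ m, FirstZero a (a - 1) m ∧ SideTop a (a - 1) 1 ((-1) ^ m) := by
  obtain ⟨m, hm⟩ := exists_firstZero
    (exists_iterate_T_eq_zero (r := a - 1) h0 h1 (by push_cast; constructor <;> linarith))
  push_cast at hm
  refine ⟨m, hm, hm.sideTop h0 h1 abs_one (sideIn_sub_one_one _) fun i hi => ?_⟩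
  rcases h1.lt_or_eq with h1 | h1
  · have := iterate_T_mem_Ioo (r := a - 1) h0 h1
      (by rw [abs_lt]; push_cast; constructor <;> linarith) (Rat.sub_intCast_den a 1) i
    exact_mod_cast this
  · have := hm.2 0 (by lia)
    simp [h1] at this

theorem exists_firstZero_sideTop_left (h0 : 0 < (a : ℝ)) (h1 : (a : ℝ) ≤ 1) :
    ∃ n, FirstZero a a n ∧ SideTop a (a - 1) (-1) ((-1) ^ n) := by
  suffices h : ∃ n, FirstZero a a n ∧ SideTop a a (-1) ((-1) ^ n) by
    obtain ⟨n, hn, h⟩ := h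
    exact ⟨n, hn, (sideTop_add_int 1).mp (by simpa using h)⟩
  rcases h1.lt_or_eq with h1 | h1
  · have hmem : ((ratT a a : ℚ) : ℝ) ∈ Ico ((a : ℝ) - 1) a := by
      rw [semiconj_ratT]
      exact T_mem_Ico h0.ne'
    obtain ⟨k, hk⟩ := exists_iterate_T_eq_zero h0 h1.le hmem
    rw [semiconj_ratT, ← Function.iterate_succ_apply] at hk
    obtain ⟨n, hn⟩ := exists_firstZero ⟨k + 1, hk⟩
    exact ⟨n, hn, hn.sideTop h0 h1.le (by simp) (sideIn_self_neg_one _) fun i _ =>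
      iterate_T_mem_Ioo h0 h1 (abs_lt.mpr ⟨by linarith, h1⟩) rfl i⟩
  · have hT : T 1 1 = 0 := by simp [T_of_ne_zero, digit]
    have hzero : SideTop 1 0 1 1 :=
      sideTop_zero one_pos le_rfl abs_one (by simpa using sideIn_sub_one_one 1)
    rw [h1]
    refine ⟨1, ⟨hT, fun i hi => ?_⟩, ?_⟩
    · simp [Nat.lt_one_iff.mp hi]
    · rw [← sideTop_T_iff one_ne_zero (sideIn_self_neg_one 1), hT, eps_of_pos one_pos]
      simpa using hzero

-- `-1` is fixed by `T 0`, and each step along it reverses the sign of the limit from the right.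
theorem not_isTypeB_zero_neg_one : ¬IsTypeB (wilton 0) (-1) := by
  intro h
  obtain ⟨s, hs, h⟩ := isTypeB_iff.mp h
  have hin : SideIn 0 (-1) 1 := by simpa using sideIn_sub_one_one 0
  have hT : T 0 (-1) = -1 := by norm_num [T_of_ne_zero, digit, eps_of_neg]
  have hneg : SideTop 0 (-1) 1 (-s) := by
    have := (sideTop_T_iff (by norm_num) hin).mpr (h 1 abs_one)
    rw [hT, eps_of_neg (by norm_num)] at this
    simpa using this
  have hs0 : s = 0 := self_eq_neg.mp ((h 1 abs_one).unique hs (by rwa [abs_neg]) hneg)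
  simp [hs0] at hs

theorem neg_one_pow_eq_neg_one_pow_iff : (-1 : ℝ) ^ m = (-1) ^ n ↔ Even ((m : ℤ) - n) := by
  rw [Int.even_sub, Int.even_coe_nat, Int.even_coe_nat]
  rcases m.even_or_odd with hm | hm <;> rcases n.even_or_odd with hn | hn <;>
    simp [hm.neg_one_pow, hn.neg_one_pow, ← Nat.not_odd_iff_even, hm, hn] <;> norm_num

theorem isTypeB_sub_one_iff (ha : (a : ℝ) ∈ Icc 0 1) :
    IsTypeB (wilton a) (a - 1) ↔ InEvenMatchingInterval a := by
  rcases ha.1.eq_or_lt with h0 | h0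
  · rw [← h0, zero_sub]
    refine iff_of_false not_isTypeB_zero_neg_one ?_
    rintro ⟨J, n, m, hJ, h, -⟩
    exact (hJ.subset_Ioc h).1.false
  · obtain ⟨m, hm, hr⟩ := exists_firstZero_sideTop_right h0 ha.2
    obtain ⟨n, hn, hl⟩ := exists_firstZero_sideTop_left h0 ha.2
    rw [isTypeB_iff_of_sideTop (by simp) (by simp) hr hl,
      inEvenMatchingInterval_iff h0 ha.2 hn hm, neg_one_pow_eq_neg_one_pow_iff]

theorem isTypeA_sub_one (h : InOddMatchingInterval a) : IsTypeA (wilton a) (a - 1) := by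
  obtain ⟨h0, h1⟩ : (a : ℝ) ∈ Ioc 0 1 := by
    obtain ⟨J, n, m, hJ, h, -⟩ := h
    exact hJ.subset_Ioc h
  obtain ⟨m, hm, hr⟩ := exists_firstZero_sideTop_right h0 h1
  obtain ⟨n, hn, hl⟩ := exists_firstZero_sideTop_left h0 h1
  have hne : (-1 : ℝ) ^ m ≠ (-1) ^ n :=
    mt neg_one_pow_eq_neg_one_pow_iff.mp (Int.not_even_iff_odd.mpr (h.odd hn hm))
  refine isTypeA_of_sideTop (by simp) hr ?_
  rcases neg_one_pow_eq_or ℝ m with h | h <;> rcases neg_one_pow_eq_or ℝ n with h' | h' <;>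
    simp_all

theorem iff_sub_one {p : ℝ → Prop} (hp : ∀ x ∈ Ioo (α - 1) α, x ≠ 0 → (p (T α x) ↔ p x))
    (hξ : ξ ∈ Ico (α - 1) α) (hit : ∃ k, (T α)^[k] ξ = α - 1) : p (α - 1) ↔ p ξ := by
  classical
  have hk := Nat.find_spec hit
  rw [← hk]
  refine iterate_T_iff hp fun i hi => ?_
  have hmem := iterate_T_mem_Ico hξ i
  have hne := Nat.find_min hit hi
  refine ⟨⟨hmem.1.lt_of_ne (Ne.symm hne), hmem.2⟩, fun h0 => hne ?_⟩
  have hfix : (T α)^[Nat.find hit] ξ = 0 := by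
    rw [← Nat.sub_add_cancel hi.le, Function.iterate_add_apply, h0,
      Function.iterate_fixed (T_zero α)]
  rw [h0, ← hk, hfix]

end RationalPoints

end AlphaCF

end

theorem theorem3p3 (α ξ : ℝ) (hα : α ∈ Set.Icc (0 : ℝ) 1) (hξ : ξ ∈ Set.Ico (α - 1) α)
    (hξQ : ξ ∈ Set.range ((↑) : ℚ → ℝ)) :
    (({α, α - 1} ∩ {y : ℝ | ∃ k : ℕ, (AlphaCF.T α)^[k] ξ = y} = ∅) →
        AlphaCF.IsTypeB (AlphaCF.wilton α) ξ) ∧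
    (({α, α - 1} ∩ {y : ℝ | ∃ k : ℕ, (AlphaCF.T α)^[k] ξ = y} ≠ ∅) →
        α ∈ Set.range ((↑) : ℚ → ℝ) ∧
        (AlphaCF.IsTypeB (AlphaCF.wilton α) ξ ↔ AlphaCF.InEvenMatchingInterval α) ∧
        (AlphaCF.InOddMatchingInterval α → AlphaCF.IsTypeA (AlphaCF.wilton α) ξ)) := by
  obtain ⟨r, rfl⟩ := hξQ
  have hit_iff : ({α, α - 1} ∩ {y : ℝ | ∃ k : ℕ, (AlphaCF.T α)^[k] r = y}).Nonempty ↔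
      ∃ k : ℕ, (AlphaCF.T α)^[k] r = α - 1 := by
    refine ⟨?_, fun hit => ⟨α - 1, Or.inr rfl, hit⟩⟩
    rintro ⟨_, rfl | rfl, k, hk⟩
    exacts [absurd hk (AlphaCF.iterate_T_mem_Ico hξ k).2.ne, ⟨k, hk⟩]
  rw [← Set.nonempty_iff_ne_empty, ← Set.not_nonempty_iff_eq_empty, hit_iff]
  refine ⟨fun h => AlphaCF.isTypeB_of_forall_iterate_ne hα hξ (not_exists.mp h), fun hit => ?_⟩
  obtain ⟨a, rfl⟩ : α ∈ Set.range ((↑) : ℚ → ℝ) := by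
    obtain ⟨k, hk⟩ := hit
    refine ⟨(AlphaCF.ratT α)^[k] r + 1, ?_⟩
    rw [Rat.cast_add, AlphaCF.cast_iterate_ratT, hk, Rat.cast_one, sub_add_cancel]
  refine ⟨⟨a, rfl⟩, ?_, fun h => ?_⟩
  · rw [← AlphaCF.isTypeB_sub_one_iff hα]
    exact (AlphaCF.iff_sub_one (fun _ => AlphaCF.isTypeB_T_iff) hξ hit).symm
  · exact (AlphaCF.iff_sub_one (fun _ => AlphaCF.isTypeA_T_iff) hξ hit).mp
      (AlphaCF.isTypeA_sub_one h)
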